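/- Let $T>0$ and let $A,B:[0,T]\to\mathbb{R}$ be continuous. Consider the Abel equation $$\frac{dx}{dt}=A(t)x^3+B(t)x^2,\qquad t\in[0,T].\qquad(\ast)$$ Assume that $\{A,B\}$ is an extended Chebyshev system with accuracy one on $[0,T)$: $A,B\in C^2([0,T))$, and every linear combination of $A$ and $B$ that is not identically zero on $[0,T)$ has at most two zeros on $[0,T)$, counted with multiplicities. A solution $x$ of $(\ast)$ on $[0,T]$ is closed if $x(0)=x(T)$; a limit cycle is an isolated closed solution; $x=0$ is a center if all solutions with initial value close to $0$ are closed. Let $x(t,x_0)$ be the solution with $x(0,x_0)=x_0$. For $x_0$ near $0$ it exists on $[0,T]$, and the displacement function $d(x_0)=x(T,x_0)-x_0$ has a convergent expansion $d(x_0)=\sum_{i\ge2}V_ix_0^i$; the $V_i$ are the Lyapunov constants of $x=0$. The multiplicity of a limit cycle is the multiplicity of its initial value as a zero of $d$ (for $x=0$: the index of the first nonzero $V_i$). Consider the conditions * **(D.1)** there is $(\lambda,\mu)\in\mathbb{R}^2\setminus\{(0,0)\}$ such that $\lambda A+\mu B\ge0$ on $[0,T)$ or $\lambda A+\mu B\le0$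 on $[0,T)$; * **(D.2)** $AB'-A'B>0$ on $[0,T)$, or $AB'-A'B<0$ on $[0,T)$. Then at least one of (D.1) and (D.2) holds, and: 1. If (D.1) holds, then $x=0$ is a center when $V_2=V_3=0$, and $x=0$ is a limit cycle, and the only limit cycle of $(\ast)$, when $V_2=0$ and $V_3\neq0$. 2. If (D.2) holds, then $x=0$ is a limit cycle of multiplicity at most four. Moreover, if $V_2=V_3=0$ and $A'B-AB'>0$ on $[0,T)$ (resp. $<0$ on $[0,T)$), then $V_4>0$ (resp. $V_4<0$). -/

import Mathlib

/-- The real function `f` has at most `N` zeros on `E`, counted with multiplicities: whenever `s` is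
a finite set of points of `E` such that at each `t ∈ s` the function `f` and its derivatives (along
`E`) of order less than `m t` vanish, the sum of the `m t` is at most `N`. -/
def AtMostZerosOn (f : ℝ → ℝ) (E : Set ℝ) (N : ℕ) : Prop :=
  ∀ (s : Finset ℝ) (m : ℝ → ℕ), (∀ t ∈ s, t ∈ E) →
    (∀ t ∈ s, ∀ j < m t, iteratedDerivWithin j f E t = 0) → ∑ t ∈ s, m t ≤ N

/-- The functions `F 0, …, F n` form an extended Chebyshev system with accuracy `k` on `E`: they are
of class `C^(n+k)` on `E`, and every linear combination of them that is not identically zero on `E`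
has at most `n + k` zeros on `E`, counted with multiplicities. (If the functions are linearly
independent, `n + k` is the dimension of their span minus one plus `k`.) -/
def IsETSystemWithAccuracy (k : ℕ) {n : ℕ} (F : Fin (n + 1) → ℝ → ℝ) (E : Set ℝ) : Prop :=
  (∀ i, ContDiffOn ℝ ((n + k : ℕ) : WithTop ℕ∞) (F i) E) ∧
  ∀ c : Fin (n + 1) → ℝ, (∃ t ∈ E, ∑ i, c i * F i t ≠ 0) →
    AtMostZerosOn (fun t => ∑ i, c i * F i t) E (n + k)

/-- Some nontrivial linear combination of `A` and `B` has a constant sign on `E`. -/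
def ConditionD1 (A B : ℝ → ℝ) (E : Set ℝ) : Prop :=
  ∃ l m : ℝ, (l, m) ≠ (0, 0) ∧
    ((∀ t ∈ E, 0 ≤ l * A t + m * B t) ∨ (∀ t ∈ E, l * A t + m * B t ≤ 0))

/-- The function `A B' - A' B` is positive on `E` or negative on `E`. -/
def ConditionD2 (A B : ℝ → ℝ) (E : Set ℝ) : Prop :=
  (∀ t ∈ E, 0 < A t * derivWithin B E t - derivWithin A E t * B t) ∨
  (∀ t ∈ E, A t * derivWithin B E t - derivWithin A E t * B t < 0)

namespace Abel

/-- `x` is a solution on `[0, T]` of the Abel equation `x' = A(t) x³ + B(t) x²`. -/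
def IsSolution (A B : ℝ → ℝ) (T : ℝ) (x : ℝ → ℝ) : Prop :=
  ∀ t ∈ Set.Icc 0 T,
    HasDerivWithinAt x (A t * x t ^ 3 + B t * x t ^ 2) (Set.Icc 0 T) t

/-- A closed solution: a solution on `[0, T]` with `x(0) = x(T)`. -/
def IsClosedSolution (A B : ℝ → ℝ) (T : ℝ) (x : ℝ → ℝ) : Prop :=
  IsSolution A B T x ∧ x 0 = x T

/-- A limit cycle: a closed solution that is isolated among the closed solutions. -/
def IsLimitCycle (A B : ℝ → ℝ) (T : ℝ) (x : ℝ → ℝ) : Prop :=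
  IsClosedSolution A B T x ∧
  ∃ ε > 0, ∀ y, IsClosedSolution A B T y → |y 0 - x 0| < ε → y 0 = x 0

/-- The solution `x = 0` is a center: all solutions starting near `0` exist on `[0, T]` and
are closed. -/
def IsCenterAtZero (A B : ℝ → ℝ) (T : ℝ) : Prop :=
  ∃ ε > 0, ∀ x₀ : ℝ, |x₀| < ε → ∃ x, IsClosedSolution A B T x ∧ x 0 = x₀

open Classical in
/-- The Poincaré map `x₀ ↦ x(T, x₀)`, where `x(·, x₀)` is the solution starting at `x₀`; its value
is set to `0` where that solution does not exist on all of `[0, T]`. -/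
noncomputable def poincareMap (A B : ℝ → ℝ) (T x₀ : ℝ) : ℝ :=
  if h : ∃ x, IsSolution A B T x ∧ x 0 = x₀ then h.choose T else 0

/-- The displacement function `d(x₀) = x(T, x₀) - x₀`. -/
noncomputable def displacement (A B : ℝ → ℝ) (T x₀ : ℝ) : ℝ :=
  poincareMap A B T x₀ - x₀

/-- The `i`-th Lyapunov constant of `x = 0`: the coefficient of `x₀ ^ i` in the power series of the
displacement function at `0`. -/
noncomputable def lyapunovConstant (A B : ℝ → ℝ) (T : ℝ) (i : ℕ) : ℝ :=
  iteratedDeriv i (displacement A B T) 0 / (i.factorial : ℝ)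

/-- `x` is a limit cycle whose multiplicity, i.e. the multiplicity of `x(0)` as a zero of the
displacement function, is `m`. -/
def IsLimitCycleOfMultiplicity (A B : ℝ → ℝ) (T : ℝ) (x : ℝ → ℝ) (m : ℕ) : Prop :=
  IsLimitCycle A B T x ∧
  (∀ j < m, iteratedDeriv j (displacement A B T) (x 0) = 0) ∧
  iteratedDeriv m (displacement A B T) (x 0) ≠ 0

end Abel

/-! Let a, b be the primitives of A, B vanishing at 0, and k that of A b. In C([0,T]) the equation
is x = s + J(A x³ + B x²), with J integration from 0. The inverse function theorem gives a solution
analytic in s, and iterating the equation gives V₂ = b(T), V₃ = a(T) + b(T)², V₄ = k(T) + 2a(T)b(T)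
+ b(T)³ (`displacement_expansion`). Hence V₂ = V₃ = 0 says that the plane curve (a, b) is closed,
and then V₄ = ∫ b da is minus its signed area.

If the Wronskian AB' − A'B vanishes at t₀, some nontrivial combination of A and B has a double zero
there. It is identically zero or has no other zero and no triple one, so it keeps its sign;
otherwise the Wronskian keeps its sign (`conditionD1_or_conditionD2`).

Let f = lA + mB ≥ 0. If V₂ = V₃ = 0, then ∫f = 0, so f = 0 and (A, B) = H'·(m, −l) with H(0) = H(T)
= 0: solutions are y ∘ H with y autonomous, hence closed. If V₂ = 0 ≠ V₃, a nonzero closed solution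
would make a function of x and b monotone with equal end values, forcing f = 0
(`eq_zero_of_conditionD1`).

If the Wronskian has a sign and (a, b) is closed, ∫ b da is compared with the integral of a product
of two linear forms, one in (a, b) and one in (A, B), whose sign changes cancel
(`primitive_neg_of_wronskian_pos`). So V₂, V₃, V₄ cannot all vanish. -/

open Filter Topology Asymptotics Set

/-! ### The cubic fixed point equation in a commutative Banach algebra. -/

section AbstractCubic

variable {E : Type*} [NormedCommRing E] [NormedAlgebra ℝ E]

/-- In a commutative Banach algebra, the equation `x = s + J (α x³ + β x²)` has a solution that
depends analytically on the small scalar `s`. -/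
theorem exists_analytic_solution_cubic [CompleteSpace E] (J : E →L[ℝ] E) (α β : E) :
    ∃ X : ℝ → E, AnalyticAt ℝ X 0 ∧ X 0 = 0 ∧
      ∀ᶠ s in 𝓝 (0 : ℝ), X s = s • (1 : E) + J (α * X s ^ 3 + β * X s ^ 2) := by
  set Φ : E → E := fun x => x - J (α * x ^ 3 + β * x ^ 2) with hΦ
  -- In `WithTop ℕ∞` the top smoothness is analyticity, so the local inverse of Φ is analytic. The
  -- derivative of Φ at 0 is the identity because the nonlinear part is at least quadratic.
  have hΦc : ContDiff ℝ ⊤ Φ := by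
    refine contDiff_id.sub (J.contDiff.comp ?_)
    exact (contDiff_const.mul (contDiff_id.pow 3)).add (contDiff_const.mul (contDiff_id.pow 2))
  have hΦ0 : Φ 0 = 0 := by simp [hΦ]
  have hd : HasFDerivAt Φ ((ContinuousLinearEquiv.refl ℝ E : E ≃L[ℝ] E) : E →L[ℝ] E) 0 := by
    have h1 : HasFDerivAt (fun x : E => α * x ^ 3 + β * x ^ 2) (0 : E →L[ℝ] E) 0 := by
      have h3 := ((hasFDerivAt_id (𝕜 := ℝ) (0 : E)).pow 3).const_mul α
      have h2 := ((hasFDerivAt_id (𝕜 := ℝ) (0 : E)).pow 2).const_mul β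
      convert! h3.add h2 using 1
      ext v
      simp
    have h2 := (hasFDerivAt_id (𝕜 := ℝ) (0 : E)).sub (J.hasFDerivAt.comp (0 : E) h1)
    convert! h2 using 1
    ext v
    simp
  have hn : (⊤ : WithTop ℕ∞) ≠ 0 := by simp
  have hc := hΦc.contDiffAt (x := 0)
  have hs : HasStrictFDerivAt Φ _ 0 := hc.hasStrictFDerivAt' hd hn
  have hinv := hc.to_localInverse hd hn
  have hr := hs.eventually_right_inverse
  rw [hΦ0] at hinv hr
  have hlin : Tendsto (fun s : ℝ => s • (1 : E)) (𝓝 0) (𝓝 0) := by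
    have : Continuous (fun s : ℝ => s • (1 : E)) := by fun_prop
    simpa using this.tendsto 0
  refine ⟨fun s => hc.localInverse hd hn (s • (1 : E)), ?_, ?_, ?_⟩
  · have ha : AnalyticAt ℝ (hc.localInverse hd hn) ((0 : ℝ) • (1 : E)) := by
      rw [zero_smul]; exact hinv.analyticAt
    exact ha.comp (f := fun s : ℝ => s • (1 : E)) (by fun_prop)
  · have := hc.localInverse_apply_image hd hn
    rw [hΦ0] at this
    simpa using this
  · filter_upwards [hlin.eventually hr] with s h
    have h' : Φ (hc.localInverse hd hn (s • (1 : E))) = s • (1 : E) := h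
    exact sub_eq_iff_eq_add.mp h'

omit [NormedAlgebra ℝ E] in
theorem isBigO_mul_pow_pow {f g : ℝ → E} {m n : ℕ}
    (hf : f =O[𝓝 0] fun s : ℝ => s ^ m) (hg : g =O[𝓝 0] fun s : ℝ => s ^ n) :
    (fun s => f s * g s) =O[𝓝 0] fun s : ℝ => s ^ (m + n) := by
  simpa only [pow_add] using hf.mul hg

theorem isBigO_pow_smul_const (m : ℕ) (v : E) :
    (fun s : ℝ => s ^ m • v) =O[𝓝 0] fun s : ℝ => s ^ m := by
  simpa using (isBigO_refl (fun s : ℝ => s ^ m) (𝓝 0)).smul (isBigO_refl (fun _ : ℝ => v) (𝓝 0)) |>.trans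
    ((isBigO_refl (fun s : ℝ => s ^ m) (𝓝 0)).smul (isBigO_const_const v (one_ne_zero (α := ℝ)) (𝓝 0)))

omit [NormedAlgebra ℝ E] in
theorem isBigO_pow_of_le {f : ℝ → E} {m n : ℕ} (h : m ≤ n)
    (hf : f =O[𝓝 0] fun s : ℝ => s ^ n) : f =O[𝓝 0] fun s : ℝ => s ^ m := by
  refine hf.trans (IsBigO.of_bound 1 ?_)
  filter_upwards [Metric.ball_mem_nhds (0 : ℝ) one_pos] with s hs
  rw [norm_pow, norm_pow, one_mul]
  exact pow_le_pow_of_le_one (norm_nonneg _) (by simpa using (mem_ball_zero_iff.mp hs).le) h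

/-- The fourth order expansion of a small solution of `x = s + J (α x³ + β x²)`. -/
theorem expansion_solution_cubic (J : E →L[ℝ] E) (α β : E) {X : ℝ → E}
    (hX : DifferentiableAt ℝ X 0) (hX0 : X 0 = 0)
    (hs : ∀ᶠ s in 𝓝 (0 : ℝ), X s = s • (1 : E) + J (α * X s ^ 3 + β * X s ^ 2)) {b c e : E}
    (hb : b = J β) (hc : c = J (α + 2 * β * b))
    (he : e = J (3 * α * b + β * (b ^ 2 + 2 * c))) :
    (fun s : ℝ => X s - (s • (1 : E) + s ^ 2 • b + s ^ 3 • c + s ^ 4 • e))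
      =O[𝓝 0] fun s : ℝ => s ^ 5 := by
  -- One round of the iteration: X − s − J v = J(αX³ + βX² − v), and J is bounded. Since the
  -- nonlinearity has no linear term, an approximation of X of order n yields one of order n + 1.
  have key : ∀ (n : ℕ) (p v q : ℝ → E), (∀ s, J (v s) = p s) →
      (∀ s, α * X s ^ 3 + β * X s ^ 2 - v s = q s) → (q =O[𝓝 0] fun s : ℝ => s ^ n) →
      (fun s => X s - (s • (1 : E) + p s)) =O[𝓝 0] fun s : ℝ => s ^ n := by
    intro n p v q hp hv hq
    refine IsBigO.congr' ((J.isBigO_comp q (𝓝 0)).trans hq) (hs.mono fun s h => ?_) .rfl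
    simp only [← hv, map_sub, hp]
    nth_rewrite 3 [h]
    abel
  have hs1 : (fun s : ℝ => s • (1 : E)) =O[𝓝 0] fun s : ℝ => s ^ 1 := by
    simpa using isBigO_pow_smul_const 1 (1 : E)
  have hcst : ∀ v : E, (fun _ : ℝ => v) =O[𝓝 0] fun s : ℝ => s ^ 0 := fun v => by
    simpa using isBigO_pow_smul_const 0 v
  have hcm : ∀ (v : E) {f : ℝ → E} {n : ℕ}, (f =O[𝓝 0] fun s : ℝ => s ^ n) →
      (fun s => v * f s) =O[𝓝 0] fun s : ℝ => s ^ n := fun v f n hf => by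
    simpa using isBigO_mul_pow_pow (hcst v) hf
  have hX1 : X =O[𝓝 0] fun s : ℝ => s ^ 1 := by
    simpa [hX0] using hX.isBigO_sub
  have hP : (fun s : ℝ => s • (1 : E) + s ^ 2 • b) =O[𝓝 0] fun s : ℝ => s ^ 1 :=
    hs1.add (isBigO_pow_of_le (by norm_num) (isBigO_pow_smul_const 2 b))
  have hQ : (fun s : ℝ => s • (1 : E) + (s ^ 2 • b + s ^ 3 • c)) =O[𝓝 0] fun s : ℝ => s ^ 1 :=
    hs1.add ((isBigO_pow_of_le (by norm_num) (isBigO_pow_smul_const 2 b)).add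
      (isBigO_pow_of_le (by norm_num) (isBigO_pow_smul_const 3 c)))
  have hXX : (fun s => X s * X s) =O[𝓝 0] fun s : ℝ => s ^ 2 := isBigO_mul_pow_pow hX1 hX1
  have r2 : (fun s => X s - (s • (1 : E) + 0)) =O[𝓝 0] fun s : ℝ => s ^ 2 := by
    refine key 2 _ (fun _ => 0) (fun s => α * (X s * (X s * X s)) + β * (X s * X s))
      (by simp) (fun s => by ring) ((hcm α ?_).add (hcm β hXX))
    exact isBigO_pow_of_le (by norm_num) (isBigO_mul_pow_pow hX1 hXX)
  have r3 : (fun s => X s - (s • (1 : E) + s ^ 2 • b)) =O[𝓝 0] fun s : ℝ => s ^ 3 := by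
    refine key 3 _ (fun s => s ^ 2 • β)
      (fun s => α * (X s * (X s * X s)) + β * ((X s - (s • (1 : E) + 0)) * (X s + s • (1 : E))))
      (by simp [hb]) (fun s => ?_) ((hcm α ?_).add (hcm β ?_))
    · simp only [Algebra.smul_def, map_pow]; ring
    · exact isBigO_mul_pow_pow hX1 hXX
    · exact isBigO_mul_pow_pow r2 (hX1.add hs1)
  have r4 : (fun s => X s - (s • (1 : E) + (s ^ 2 • b + s ^ 3 • c))) =O[𝓝 0]
      fun s : ℝ => s ^ 4 := by
    refine key 4 _ (fun s => s ^ 2 • β + s ^ 3 • (α + 2 * β * b))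
      (fun s => α * ((X s - (s • (1 : E) + 0)) *
          (X s * X s + X s * s • (1 : E) + s • (1 : E) * s • (1 : E))) +
        β * ((X s - (s • (1 : E) + s ^ 2 • b)) * (X s + (s • (1 : E) + s ^ 2 • b)) +
          s ^ 4 • b ^ 2))
      (fun s => by rw [map_add, map_smul, map_smul, ← hb, ← hc]) (fun s => ?_)
      ((hcm α ?_).add (hcm β ?_))
    · simp only [Algebra.smul_def, map_pow]; ring
    · exact isBigO_mul_pow_pow r2
        ((hXX.add (isBigO_mul_pow_pow hX1 hs1)).add (isBigO_mul_pow_pow hs1 hs1))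
    · exact (isBigO_mul_pow_pow r3 (hX1.add hP)).add (isBigO_pow_smul_const 4 _)
  have r5 : (fun s => X s - (s • (1 : E) + (s ^ 2 • b + s ^ 3 • c + s ^ 4 • e))) =O[𝓝 0]
      fun s : ℝ => s ^ 5 := by
    refine key 5 _ (fun s => s ^ 2 • β + s ^ 3 • (α + 2 * β * b) +
        s ^ 4 • (3 * α * b + β * (b ^ 2 + 2 * c)))
      (fun s => α * ((X s - (s • (1 : E) + s ^ 2 • b)) *
          (X s * X s + X s * (s • (1 : E) + s ^ 2 • b) +
            (s • (1 : E) + s ^ 2 • b) * (s • (1 : E) + s ^ 2 • b)) +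
          (s ^ 5 • (3 * b ^ 2) + s ^ 6 • b ^ 3)) +
        β * ((X s - (s • (1 : E) + (s ^ 2 • b + s ^ 3 • c))) *
            (X s + (s • (1 : E) + (s ^ 2 • b + s ^ 3 • c))) +
          (s ^ 5 • (2 * b * c) + s ^ 6 • c ^ 2)))
      (fun s => by rw [map_add, map_add, map_smul, map_smul, map_smul, ← hb, ← hc, ← he])
      (fun s => ?_) ((hcm α ?_).add (hcm β ?_))
    · simp only [Algebra.smul_def, map_pow]; ring
    · exact (isBigO_mul_pow_pow r3
        ((hXX.add (isBigO_mul_pow_pow hX1 hP)).add (isBigO_mul_pow_pow hP hP))).add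
        ((isBigO_pow_smul_const 5 _).add
          (isBigO_pow_of_le (by norm_num) (isBigO_pow_smul_const 6 _)))
    · exact (isBigO_mul_pow_pow r4 (hX1.add hQ)).add
        ((isBigO_pow_smul_const 5 _).add
          (isBigO_pow_of_le (by norm_num) (isBigO_pow_smul_const 6 _)))
  simpa only [add_assoc] using r5

end AbstractCubic

/-- Functions with the same derivative along a real interval and the same value at one point agree
on the interval. -/
theorem eqOn_Icc_of_hasDerivWithinAt {a b t₀ : ℝ} (h0 : t₀ ∈ Icc a b) {f g f' : ℝ → ℝ}
    (hf : ∀ t ∈ Icc a b, HasDerivWithinAt f (f' t) (Icc a b) t)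
    (hg : ∀ t ∈ Icc a b, HasDerivWithinAt g (f' t) (Icc a b) t) (h : f t₀ = g t₀) :
    EqOn f g (Icc a b) := by
  intro t ht
  have := (convex_Icc a b).norm_image_sub_le_of_norm_hasDerivWithin_le (C := 0)
    (fun x hx => (hf x hx).sub (hg x hx)) (fun x _ => by simp) h0 ht
  simp only [Pi.sub_apply, h, sub_self, sub_zero, zero_mul, norm_le_zero_iff] at this
  exact sub_eq_zero.mp this

/-! ### Integration from 0 as a bounded operator on C([a, b]). -/

section Volterra

variable {a b : ℝ} (h0 : (0 : ℝ) ∈ Icc a b)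

theorem hasDerivAt_integral_IccExtend (f : C(Icc a b, ℝ)) (t : ℝ) :
    HasDerivAt (fun u => ∫ s in (0 : ℝ)..u, IccExtend (h0.1.trans h0.2) f s)
      (IccExtend (h0.1.trans h0.2) f t) t := by
  have hc : Continuous (IccExtend (h0.1.trans h0.2) f) := f.continuous.Icc_extend'
  exact intervalIntegral.integral_hasDerivAt_right (hc.intervalIntegrable _ _)
    hc.aestronglyMeasurable.stronglyMeasurableAtFilter hc.continuousAt

/-- The operator that maps a continuous function on `[a, b]` to its primitive vanishing at `0`. -/
noncomputable def volterra : C(Icc a b, ℝ) →L[ℝ] C(Icc a b, ℝ) :=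
  LinearMap.mkContinuous
    { toFun := fun f =>
        ⟨fun t => ∫ s in (0 : ℝ)..t, IccExtend (h0.1.trans h0.2) f s,
          (continuous_iff_continuousAt.mpr fun t =>
            (hasDerivAt_integral_IccExtend h0 f t).continuousAt).comp continuous_subtype_val⟩
      map_add' := fun f g => by
        ext t
        have hf : Continuous (IccExtend (h0.1.trans h0.2) f) := f.continuous.Icc_extend'
        have hg : Continuous (IccExtend (h0.1.trans h0.2) g) := g.continuous.Icc_extend'
        exact intervalIntegral.integral_add (hf.intervalIntegrable _ _) (hg.intervalIntegrable _ _)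
      map_smul' := fun r f => by
        ext t
        exact intervalIntegral.integral_smul r _ }
    (b - a) (fun f => by
      rw [ContinuousMap.norm_le _ (mul_nonneg (by linarith [h0.1, h0.2]) (norm_nonneg _))]
      intro t
      have h1 : ‖∫ s in (0 : ℝ)..t, IccExtend (h0.1.trans h0.2) f s‖ ≤ ‖f‖ * |(t : ℝ) - 0| :=
        intervalIntegral.norm_integral_le_of_norm_le_const fun s _ => f.norm_coe_le_norm _
      refine h1.trans ?_
      rw [mul_comm]
      refine mul_le_mul_of_nonneg_right ?_ (norm_nonneg _)
      have := t.2.1; have := t.2.2; have := h0.1; have := h0.2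
      rw [abs_le]; constructor <;> linarith)

theorem volterra_apply (f : C(Icc a b, ℝ)) (t : Icc a b) :
    volterra h0 f t = ∫ s in (0 : ℝ)..t, IccExtend (h0.1.trans h0.2) f s := rfl

/-- The value of `volterra` is determined by the derivative and the initial value. -/
theorem volterra_apply_eq (f : C(Icc a b, ℝ)) {g f' : ℝ → ℝ} (hf : ∀ t : Icc a b, f t = f' t)
    (hg : ∀ t ∈ Icc a b, HasDerivWithinAt g (f' t) (Icc a b) t) (hg0 : g 0 = 0)
    (t : Icc a b) : volterra h0 f t = g t := by
  rw [volterra_apply]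
  refine eqOn_Icc_of_hasDerivWithinAt h0
    (f := fun u => ∫ s in (0 : ℝ)..u, IccExtend (h0.1.trans h0.2) f s) (f' := f')
    (fun u hu => ?_) hg (by simp [hg0]) t.2
  have := (hasDerivAt_integral_IccExtend h0 f u).hasDerivWithinAt (s := Icc a b)
  rwa [IccExtend_of_mem _ _ hu, hf] at this

end Volterra

/-- A continuous function on an interval has a primitive. -/
theorem exists_primitive {a b : ℝ} (h0 : (0 : ℝ) ∈ Icc a b) {f : ℝ → ℝ}
    (hf : ContinuousOn f (Icc a b)) :
    ∃ F : ℝ → ℝ, F 0 = 0 ∧ ∀ t ∈ Icc a b, HasDerivWithinAt F (f t) (Icc a b) t := by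
  refine ⟨fun u => ∫ s in (0 : ℝ)..u, IccExtend (h0.1.trans h0.2) ((Icc a b).domRestrict f) s,
    by simp, fun t ht => ?_⟩
  have := (hasDerivAt_integral_IccExtend h0 ⟨_, hf.domRestrict⟩ t).hasDerivWithinAt (s := Icc a b)
  rwa [IccExtend_of_mem _ _ ht] at this

/-! ### From the fixed point equation to the differential equation. -/

section SmallSolutions

variable {a b : ℝ} (h0 : (0 : ℝ) ∈ Icc a b) (α β : C(Icc a b, ℝ))

/-- The fixed point equation is the integral form of the initial value problem. The interval may
extend to both sides of 0, as the autonomous equation behind the center requires. -/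
theorem hasDerivWithinAt_of_eq_volterra {X : C(Icc a b, ℝ)} {s : ℝ}
    (h : X = s • (1 : C(Icc a b, ℝ)) + volterra h0 (α * X ^ 3 + β * X ^ 2)) :
    (∀ t : Icc a b, HasDerivWithinAt (IccExtend (h0.1.trans h0.2) X)
      (α t * X t ^ 3 + β t * X t ^ 2) (Icc a b) t) ∧ X ⟨0, h0⟩ = s := by
  have hp : ∀ t : Icc a b, X t = s +
      ∫ u in (0 : ℝ)..t, IccExtend (h0.1.trans h0.2) (⇑(α * X ^ 3 + β * X ^ 2)) u := fun t => by
    conv_lhs => rw [h]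
    rw [ContinuousMap.add_apply, volterra_apply]
    simp only [ContinuousMap.smul_apply, ContinuousMap.one_apply, smul_eq_mul, mul_one]
  refine ⟨fun t => ?_, by rw [hp]; simp⟩
  have h1 := ((hasDerivAt_integral_IccExtend h0 (α * X ^ 3 + β * X ^ 2) t).const_add
    s).hasDerivWithinAt (s := Icc a b)
  rw [IccExtend_of_mem _ _ t.2] at h1
  refine h1.congr (fun u hu => ?_) ?_
  · rw [IccExtend_of_mem _ _ hu, hp]
  · rw [IccExtend_of_mem _ _ t.2, hp]

end SmallSolutions

/-! ### Taylor coefficients from an asymptotic expansion. -/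

/-- An analytic function that is `O(s ^ n)` at `0` has vanishing derivatives of order less
than `n`. -/
theorem AnalyticAt.iteratedDeriv_eq_zero_of_isBigO {f : ℝ → ℝ} (hf : AnalyticAt ℝ f 0) {n : ℕ}
    (h : f =O[𝓝 0] fun s : ℝ => s ^ n) : ∀ i < n, iteratedDeriv i f 0 = 0 := by
  rw [← natCast_le_analyticOrderAt_iff_iteratedDeriv_eq_zero hf]
  by_contra hlt
  rw [not_le] at hlt
  obtain ⟨m, hm⟩ := ENat.ne_top_iff_exists.mp hlt.ne_top
  rw [← hm, Nat.cast_lt] at hlt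
  obtain ⟨g, hg, hg0, hfg⟩ := hf.analyticOrderAt_eq_natCast.mp hm.symm
  -- If the order m were below n, the quotient f(s)/sᵐ would tend both to 0 and to the nonzero
  -- leading coefficient g(0).
  have h1 : f =o[𝓝 0] fun s : ℝ => s ^ m :=
    h.trans_isLittleO (isLittleO_pow_pow hlt)
  have h2 : Tendsto (fun s => f s / s ^ m) (𝓝[≠] 0) (𝓝 0) :=
    (h1.tendsto_div_nhds_zero).mono_left nhdsWithin_le_nhds
  have h3 : Tendsto (fun s => f s / s ^ m) (𝓝[≠] 0) (𝓝 (g 0)) := by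
    refine (hg.continuousAt.tendsto.mono_left nhdsWithin_le_nhds).congr' ?_
    filter_upwards [nhdsWithin_le_nhds hfg, self_mem_nhdsWithin] with s hs hs0
    have : s ^ m ≠ 0 := pow_ne_zero _ hs0
    rw [hs, sub_zero, smul_eq_mul]
    field_simp
  exact hg0 (tendsto_nhds_unique h3 h2)

/-- The first derivatives at `0` of an analytic function with a given polynomial part of
order `4`. -/
theorem AnalyticAt.iteratedDeriv_of_expansion {f : ℝ → ℝ} (hf : AnalyticAt ℝ f 0) {p q r : ℝ}
    (h : (fun s => f s - (s ^ 2 * p + s ^ 3 * q + s ^ 4 * r)) =O[𝓝 0] fun s : ℝ => s ^ 5) :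
    iteratedDeriv 0 f 0 = 0 ∧ iteratedDeriv 1 f 0 = 0 ∧ iteratedDeriv 2 f 0 = 2 * p ∧
      iteratedDeriv 3 f 0 = 6 * q ∧ iteratedDeriv 4 f 0 = 24 * r := by
  have hP : AnalyticAt ℝ (fun s : ℝ => s ^ 2 * p + s ^ 3 * q + s ^ 4 * r) 0 := by fun_prop
  have h1 := AnalyticAt.iteratedDeriv_eq_zero_of_isBigO (hf.sub hP) h
  have h2 : ∀ i < 5, iteratedDeriv i f 0 =
      iteratedDeriv i (fun s : ℝ => s ^ 2 * p + s ^ 3 * q + s ^ 4 * r) 0 := fun i hi => by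
    have := h1 i hi
    rwa [iteratedDeriv_sub hf.contDiffAt hP.contDiffAt, sub_eq_zero] at this
  have h3 : ∀ i, iteratedDeriv i (fun s : ℝ => s ^ 2 * p + s ^ 3 * q + s ^ 4 * r) 0 =
      iteratedDeriv i (fun s : ℝ => s ^ 2) 0 * p + iteratedDeriv i (fun s : ℝ => s ^ 3) 0 * q +
        iteratedDeriv i (fun s : ℝ => s ^ 4) 0 * r := fun i => by
    have e : (fun s : ℝ => s ^ 2 * p + s ^ 3 * q + s ^ 4 * r) =
      (fun s : ℝ => s ^ 2 * p) + (fun s : ℝ => s ^ 3 * q) + (fun s : ℝ => s ^ 4 * r) := rfl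
    have hc : ∀ (n : ℕ) (v : ℝ), ContDiffAt ℝ i (fun s : ℝ => s ^ n * v) 0 := fun n v => by
      fun_prop
    have hpq : ContDiffAt ℝ i ((fun s : ℝ => s ^ 2 * p) + (fun s : ℝ => s ^ 3 * q)) 0 :=
      (hc 2 p).add (hc 3 q)
    rw [e, iteratedDeriv_add hpq (hc 4 r),
      iteratedDeriv_add (hc 2 p) (hc 3 q), iteratedDeriv_mul_const_field,
      iteratedDeriv_mul_const_field, iteratedDeriv_mul_const_field]
  refine ⟨?_, ?_, ?_, ?_, ?_⟩ <;>
    · rw [h2 _ (by norm_num), h3, iteratedDeriv_fun_pow_zero, iteratedDeriv_fun_pow_zero,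
        iteratedDeriv_fun_pow_zero]
      norm_num [Nat.factorial]

/-! ### Linear equations, uniqueness and the Poincaré map. -/

/-- Integrating factor: `exp (-P)` turns the linear equation `z' = p z + q` into an equation for a
primitive. -/
theorem exists_integrating_factor {a b : ℝ} (h0 : (0 : ℝ) ∈ Icc a b) {p : ℝ → ℝ}
    (hp : ContinuousOn p (Icc a b)) :
    ∃ P : ℝ → ℝ, ∀ z q : ℝ → ℝ,
      (∀ t ∈ Icc a b, HasDerivWithinAt z (p t * z t + q t) (Icc a b) t) →
      ∀ t ∈ Icc a b, HasDerivWithinAt (fun t => Real.exp (-P t) * z t)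
        (Real.exp (-P t) * q t) (Icc a b) t := by
  obtain ⟨P, -, hP⟩ := exists_primitive h0 hp
  refine ⟨P, fun z q hz t ht => ?_⟩
  convert! ((hP t ht).neg.exp).mul (hz t ht) using 1
  rw [Pi.neg_apply]
  ring

/-- A solution of a homogeneous linear equation that vanishes at one point vanishes. -/
theorem eq_zero_of_linear {a b t₀ : ℝ} (h0 : (0 : ℝ) ∈ Icc a b) (ht₀ : t₀ ∈ Icc a b) {p z : ℝ → ℝ}
    (hp : ContinuousOn p (Icc a b))
    (hz : ∀ t ∈ Icc a b, HasDerivWithinAt z (p t * z t) (Icc a b) t) (h : z t₀ = 0) :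
    ∀ t ∈ Icc a b, z t = 0 := by
  obtain ⟨P, hP⟩ := exists_integrating_factor h0 hp
  have h1 := hP z (fun _ => 0) (fun t ht => by simpa using hz t ht)
  intro t ht
  have := eqOn_Icc_of_hasDerivWithinAt (g := fun _ => 0) ht₀ h1
    (fun t _ => by simpa using hasDerivWithinAt_const t (Icc a b) (0 : ℝ)) (by simp [h]) ht
  simpa using this

namespace Abel

variable {T : ℝ} {A B : ℝ → ℝ}

theorem IsSolution.continuousOn {x : ℝ → ℝ} (hx : IsSolution A B T x) :
    ContinuousOn x (Icc 0 T) := fun t ht => (hx t ht).continuousWithinAt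

/-- Solutions that agree at one point agree. -/
theorem IsSolution.eqOn (hT : 0 ≤ T) (hA : ContinuousOn A (Icc 0 T))
    (hB : ContinuousOn B (Icc 0 T)) {x y : ℝ → ℝ} (hx : IsSolution A B T x)
    (hy : IsSolution A B T y) {t₀ : ℝ} (ht₀ : t₀ ∈ Icc 0 T) (h : x t₀ = y t₀) :
    EqOn x y (Icc 0 T) := by
  have hxc := hx.continuousOn
  have hyc := hy.continuousOn
  intro t ht
  -- Factoring x³ − y³ and x² − y² makes the difference of two solutions solve a homogeneous linear
  -- equation.
  have := eq_zero_of_linear (z := fun t => x t - y t)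
    (p := fun t => A t * (x t ^ 2 + x t * y t + y t ^ 2) + B t * (x t + y t))
    ⟨le_rfl, hT⟩ ht₀ (by fun_prop)
    (fun t ht => by convert! (hx t ht).sub (hy t ht) using 1; ring) (by simp [h]) t ht
  exact sub_eq_zero.mp this

theorem isSolution_zero : IsSolution A B T (fun _ => 0) := fun t _ => by
  simpa using hasDerivWithinAt_const t (Icc 0 T) (0 : ℝ)

theorem isClosedSolution_zero : IsClosedSolution A B T (fun _ => 0) := ⟨isSolution_zero, rfl⟩

/-- By uniqueness, the solution picked by choice in `poincareMap` does not matter. -/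
theorem IsSolution.poincareMap_eq (hT : 0 ≤ T) (hA : ContinuousOn A (Icc 0 T))
    (hB : ContinuousOn B (Icc 0 T)) {x : ℝ → ℝ} (hx : IsSolution A B T x) :
    poincareMap A B T (x 0) = x T := by
  have h : ∃ y, IsSolution A B T y ∧ y 0 = x 0 := ⟨x, hx, rfl⟩
  rw [poincareMap, dif_pos h]
  exact h.choose_spec.1.eqOn hT hA hB hx ⟨le_rfl, hT⟩ h.choose_spec.2 ⟨hT, le_rfl⟩

theorem IsClosedSolution.displacement_eq_zero (hT : 0 ≤ T) (hA : ContinuousOn A (Icc 0 T))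
    (hB : ContinuousOn B (Icc 0 T)) {x : ℝ → ℝ} (hx : IsClosedSolution A B T x) :
    displacement A B T (x 0) = 0 := by
  rw [displacement, hx.1.poincareMap_eq hT hA hB, hx.2, sub_self]

end Abel

/-- The scalar equation `x' = A x³ + B x²` has solutions on `[a, b]` with any small value
at `0`. -/
theorem exists_small_solution {a b : ℝ} (h0 : (0 : ℝ) ∈ Icc a b) {A B : ℝ → ℝ}
    (hA : ContinuousOn A (Icc a b)) (hB : ContinuousOn B (Icc a b)) :
    ∀ᶠ s in 𝓝 (0 : ℝ), ∃ x : ℝ → ℝ, x 0 = s ∧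
      ∀ t ∈ Icc a b, HasDerivWithinAt x (A t * x t ^ 3 + B t * x t ^ 2) (Icc a b) t := by
  obtain ⟨X, -, -, hX⟩ := exists_analytic_solution_cubic (volterra h0) ⟨_, hA.domRestrict⟩
    ⟨_, hB.domRestrict⟩
  filter_upwards [hX] with s hs
  obtain ⟨h1, h2⟩ := hasDerivWithinAt_of_eq_volterra h0 _ _ hs
  refine ⟨IccExtend (h0.1.trans h0.2) (X s), ?_, fun t ht => ?_⟩
  · rw [IccExtend_of_mem _ _ h0, h2]
  · have := h1 ⟨t, ht⟩
    rw [← IccExtend_of_mem (h0.1.trans h0.2) (X s) ht] at this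
    exact this

/-! ### The displacement function and its Lyapunov constants. -/

namespace Abel

variable {T : ℝ} {A B : ℝ → ℝ}

/-- The displacement function is analytic at `0`, and its expansion to fourth order is given by
iterated primitives. -/
theorem displacement_expansion (hT : 0 ≤ T) (hA : ContinuousOn A (Icc 0 T))
    (hB : ContinuousOn B (Icc 0 T)) {a b k : ℝ → ℝ}
    (ha : ∀ t ∈ Icc 0 T, HasDerivWithinAt a (A t) (Icc 0 T) t) (ha0 : a 0 = 0)
    (hb : ∀ t ∈ Icc 0 T, HasDerivWithinAt b (B t) (Icc 0 T) t) (hb0 : b 0 = 0)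
    (hk : ∀ t ∈ Icc 0 T, HasDerivWithinAt k (A t * b t) (Icc 0 T) t) (hk0 : k 0 = 0) :
    AnalyticAt ℝ (displacement A B T) 0 ∧
    (fun s => displacement A B T s - (s ^ 2 * b T + s ^ 3 * (a T + b T ^ 2) +
      s ^ 4 * (k T + 2 * a T * b T + b T ^ 3))) =O[𝓝 0] fun s : ℝ => s ^ 5 := by
  have h0 : (0 : ℝ) ∈ Icc 0 T := ⟨le_rfl, hT⟩
  set α : C(Icc 0 T, ℝ) := ⟨_, hA.domRestrict⟩
  set β : C(Icc 0 T, ℝ) := ⟨_, hB.domRestrict⟩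
  obtain ⟨X, hXa, hX0, hX⟩ := exists_analytic_solution_cubic (volterra h0) α β
  set ev : C(Icc 0 T, ℝ) →L[ℝ] ℝ := ContinuousMap.evalCLM ℝ (⟨T, hT, le_rfl⟩ : Icc 0 T)
  have hd : ∀ᶠ s in 𝓝 (0 : ℝ), ev (X s) - s = displacement A B T s := by
    filter_upwards [hX] with s hs
    obtain ⟨h1, h2⟩ := hasDerivWithinAt_of_eq_volterra h0 _ _ hs
    have hsol : IsSolution A B T (IccExtend hT (X s)) := fun t ht => by
      have := h1 ⟨t, ht⟩
      rw [← IccExtend_of_mem hT (X s) ht] at this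
      exact this
    have := hsol.poincareMap_eq hT hA hB
    rw [IccExtend_of_mem _ _ h0, h2, IccExtend_of_mem _ _ (right_mem_Icc.mpr hT)] at this
    rw [displacement, this]
    rfl
  have hbe : ∀ t : Icc 0 T, volterra h0 β t = b t :=
    volterra_apply_eq h0 _ (fun _ => rfl) hb hb0
  -- The iterated integrals are evaluated by exhibiting primitives: a + b² for the cubic coefficient
  -- c, and k + 2ab + b³ for the quartic one e.
  obtain ⟨c, hc⟩ : ∃ c, c = volterra h0 (α + 2 * β * volterra h0 β) := ⟨_, rfl⟩
  have hce : ∀ t : Icc 0 T, c t = a t + b t ^ 2 := by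
    rw [hc]
    refine volterra_apply_eq h0 _ (f' := fun t => A t + 2 * B t * b t)
      (g := fun t => a t + b t ^ 2) (fun t => ?_) (fun t ht => ?_) (by simp [ha0, hb0])
    · simp only [ContinuousMap.add_apply, ContinuousMap.mul_apply, hbe]; rfl
    · convert! (ha t ht).add ((hb t ht).pow 2) using 1; push_cast; ring
  obtain ⟨e, he⟩ : ∃ e, e = volterra h0 (3 * α * volterra h0 β + β * ((volterra h0 β) ^ 2 +
      2 * c)) := ⟨_, rfl⟩
  have hee : ∀ t : Icc 0 T, e t = k t + 2 * a t * b t + b t ^ 3 := by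
    rw [he]
    refine volterra_apply_eq h0 _
      (f' := fun t => 3 * A t * b t + B t * (b t ^ 2 + 2 * (a t + b t ^ 2)))
      (g := fun t => k t + 2 * a t * b t + b t ^ 3) (fun t => ?_) (fun t ht => ?_)
      (by simp [hk0, ha0, hb0])
    · simp only [ContinuousMap.add_apply, ContinuousMap.mul_apply, ContinuousMap.pow_apply, hbe,
        hce]; rfl
    · convert! ((hk t ht).add (((ha t ht).const_mul 2).mul (hb t ht))).add ((hb t ht).pow 3) using 1
      push_cast; ring
  have hXe := expansion_solution_cubic (volterra h0) α β hXa.differentiableAt hX0 hX rfl hc he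
  refine ⟨AnalyticAt.congr ?_ hd, ?_⟩
  · exact ((ev.analyticAt _).comp hXa).sub analyticAt_id
  · refine IsBigO.congr' ((ev.isBigO_comp _ (𝓝 0)).trans hXe) ?_ .rfl
    filter_upwards [hd] with s hs
    rw [← hs]
    have e1 : ev (volterra h0 β) = b T := hbe _
    have e2 : ev c = a T + b T ^ 2 := hce _
    have e3 : ev e = k T + 2 * a T * b T + b T ^ 3 := hee _
    have e4 : ev 1 = 1 := rfl
    simp only [map_sub, map_add, map_smul, e1, e2, e3, e4, smul_eq_mul]
    ring

/-- The first Lyapunov constants. -/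
theorem lyapunovConstant_eq (hT : 0 ≤ T) (hA : ContinuousOn A (Icc 0 T))
    (hB : ContinuousOn B (Icc 0 T)) {a b k : ℝ → ℝ}
    (ha : ∀ t ∈ Icc 0 T, HasDerivWithinAt a (A t) (Icc 0 T) t) (ha0 : a 0 = 0)
    (hb : ∀ t ∈ Icc 0 T, HasDerivWithinAt b (B t) (Icc 0 T) t) (hb0 : b 0 = 0)
    (hk : ∀ t ∈ Icc 0 T, HasDerivWithinAt k (A t * b t) (Icc 0 T) t) (hk0 : k 0 = 0) :
    lyapunovConstant A B T 0 = 0 ∧ lyapunovConstant A B T 1 = 0 ∧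
    lyapunovConstant A B T 2 = b T ∧ lyapunovConstant A B T 3 = a T + b T ^ 2 ∧
    lyapunovConstant A B T 4 = k T + 2 * a T * b T + b T ^ 3 := by
  obtain ⟨h1, h2⟩ := displacement_expansion hT hA hB ha ha0 hb hb0 hk hk0
  obtain ⟨d0, d1, d2, d3, d4⟩ := h1.iteratedDeriv_of_expansion h2
  simp only [lyapunovConstant, d0, d1, d2, d3, d4, Nat.factorial]
  refine ⟨by simp, by simp, ?_, ?_, ?_⟩ <;> push_cast <;> ring

theorem iteratedDeriv_displacement (i : ℕ) :
    iteratedDeriv i (displacement A B T) 0 = lyapunovConstant A B T i * i.factorial := by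
  rw [lyapunovConstant, div_mul_cancel₀ _ (by exact_mod_cast i.factorial_ne_zero)]

theorem exists_primitives (hT : 0 ≤ T) (hA : ContinuousOn A (Icc 0 T))
    (hB : ContinuousOn B (Icc 0 T)) :
    ∃ a b k : ℝ → ℝ, (∀ t ∈ Icc 0 T, HasDerivWithinAt a (A t) (Icc 0 T) t) ∧ a 0 = 0 ∧
      (∀ t ∈ Icc 0 T, HasDerivWithinAt b (B t) (Icc 0 T) t) ∧ b 0 = 0 ∧
      (∀ t ∈ Icc 0 T, HasDerivWithinAt k (A t * b t) (Icc 0 T) t) ∧ k 0 = 0 := by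
  have h0 : (0 : ℝ) ∈ Icc 0 T := ⟨le_rfl, hT⟩
  obtain ⟨a, ha0, ha⟩ := exists_primitive h0 hA
  obtain ⟨b, hb0, hb⟩ := exists_primitive h0 hB
  obtain ⟨k, hk0, hk⟩ := exists_primitive h0
    (hA.mul fun t ht => (hb t ht).continuousWithinAt)
  exact ⟨a, b, k, ha, ha0, hb, hb0, hk, hk0⟩

/-- The displacement function is the sum of the series of the Lyapunov constants. -/
theorem hasSum_displacement (hT : 0 ≤ T) (hA : ContinuousOn A (Icc 0 T))
    (hB : ContinuousOn B (Icc 0 T)) :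
    ∃ r > 0, ∀ x₀ : ℝ, |x₀| < r → (∃ x, IsSolution A B T x ∧ x 0 = x₀) ∧
      HasSum (fun i : ℕ => lyapunovConstant A B T (i + 2) * x₀ ^ (i + 2))
        (displacement A B T x₀) := by
  obtain ⟨a, b, k, ha, ha0, hb, hb0, hk, hk0⟩ := exists_primitives hT hA hB
  have h1 := (displacement_expansion hT hA hB ha ha0 hb hb0 hk hk0).1
  obtain ⟨v0, v1, -⟩ := lyapunovConstant_eq hT hA hB ha ha0 hb hb0 hk hk0
  have h2 := h1.hasFPowerSeriesAt.eventually_hasSum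
  obtain ⟨r, hr, hall⟩ := Metric.eventually_nhds_iff.mp
    (h2.and (exists_small_solution (A := A) (B := B) ⟨le_rfl, hT⟩ hA hB))
  refine ⟨r, hr, fun x₀ hx₀ => ?_⟩
  obtain ⟨hs, x, hx0, hx⟩ := hall (y := x₀) (by simpa using hx₀)
  refine ⟨⟨x, hx, hx0⟩, ?_⟩
  have hs' : HasSum (fun i : ℕ => lyapunovConstant A B T i * x₀ ^ i) (displacement A B T x₀) := by
    simpa [FormalMultilinearSeries.ofScalars_apply_eq, lyapunovConstant, mul_comm] using hs
  have := (hasSum_nat_add_iff' 2).mpr hs'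
  simpa [Finset.sum_range_succ, v0, v1] using this

/-- A nonvanishing Lyapunov constant isolates the zero solution. -/
theorem isLimitCycle_zero (hT : 0 ≤ T) (hA : ContinuousOn A (Icc 0 T))
    (hB : ContinuousOn B (Icc 0 T)) {m : ℕ} (hm : lyapunovConstant A B T m ≠ 0) :
    IsLimitCycle A B T (fun _ => 0) := by
  obtain ⟨a, b, k, ha, ha0, hb, hb0, hk, hk0⟩ := exists_primitives hT hA hB
  have h1 := (displacement_expansion hT hA hB ha ha0 hb hb0 hk hk0).1
  refine ⟨isClosedSolution_zero, ?_⟩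
  -- Zeros of an analytic function are isolated unless it vanishes nearby, and then all Lyapunov
  -- constants are zero.
  rcases h1.eventually_eq_zero_or_eventually_ne_zero with h | h
  · refine absurd ?_ hm
    rw [lyapunovConstant, Filter.EventuallyEq.iteratedDeriv_eq m (g := fun _ => 0) h]
    simp
  · obtain ⟨ε, hε, hne⟩ := Metric.eventually_nhds_iff.mp (eventually_nhdsWithin_iff.mp h)
    refine ⟨ε, hε, fun y hy hy0 => ?_⟩
    by_contra hy1
    exact hne (y := y 0) (by simpa using hy0) hy1 (hy.displacement_eq_zero hT hA hB)

end Abel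

/-! ### Sign and monotonicity arguments. -/

/-- A continuous function without zeros on a connected set has constant sign. -/
theorem pos_or_neg_of_ne_zero {s : Set ℝ} (hs : IsPreconnected s) {f : ℝ → ℝ}
    (hf : ContinuousOn f s) (h : ∀ t ∈ s, f t ≠ 0) :
    (∀ t ∈ s, 0 < f t) ∨ (∀ t ∈ s, f t < 0) := by
  by_contra! hcon
  obtain ⟨⟨t, ht, hft⟩, u, hu, hfu⟩ := hcon
  obtain ⟨v, hv, hv0⟩ := hs.intermediate_value ht hu hf ⟨hft, hfu⟩
  exact h v hv hv0

theorem ConditionD1.exists_nonneg {A B : ℝ → ℝ} {E : Set ℝ} (h : ConditionD1 A B E) :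
    ∃ l m : ℝ, (l, m) ≠ (0, 0) ∧ ∀ t ∈ E, 0 ≤ l * A t + m * B t := by
  obtain ⟨l, m, hlm, h | h⟩ := h
  · exact ⟨l, m, hlm, h⟩
  · refine ⟨-l, -m, ?_, fun t ht => by linarith [h t ht]⟩
    simpa using hlm

section Monotonicity

variable {T : ℝ} {f r F : ℝ → ℝ}

/-- If the derivative `f r`, with `f ≥ 0` and `r` of one sign, integrates to zero, then `f = 0`. -/
theorem eq_zero_of_hasDerivWithinAt_mul (hT : 0 < T)
    (hF : ∀ t ∈ Icc 0 T, HasDerivWithinAt F (f t * r t) (Icc 0 T) t)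
    (hf : ∀ t ∈ Ico 0 T, 0 ≤ f t)
    (hr : (∀ t ∈ Icc 0 T, 0 < r t) ∨ (∀ t ∈ Icc 0 T, r t < 0)) (h : F 0 = F T) :
    ∀ t ∈ Icc 0 T, f t = 0 := by
  have hc : ContinuousOn F (Icc 0 T) := fun t ht => (hF t ht).continuousWithinAt
  have hd : ∀ t ∈ interior (Icc 0 T), HasDerivWithinAt F (f t * r t) (interior (Icc 0 T)) t :=
    fun t ht => (hF t (interior_subset ht)).mono interior_subset
  have hconst : ∀ t ∈ Icc 0 T, F t = F 0 := by
    intro t ht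
    rcases hr with hr | hr
    · have hm : MonotoneOn F (Icc 0 T) := by
        refine monotoneOn_of_hasDerivWithinAt_nonneg (convex_Icc 0 T) hc hd fun t ht => ?_
        have ht' := interior_subset ht
        rw [interior_Icc] at ht
        exact mul_nonneg (hf t ⟨ht.1.le, ht.2⟩) (hr t ht').le
      exact le_antisymm (h ▸ hm ht (right_mem_Icc.mpr hT.le) ht.2)
        (hm (left_mem_Icc.mpr hT.le) ht ht.1)
    · have hm : AntitoneOn F (Icc 0 T) := by
        refine antitoneOn_of_hasDerivWithinAt_nonpos (convex_Icc 0 T) hc hd fun t ht => ?_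
        have ht' := interior_subset ht
        rw [interior_Icc] at ht
        exact mul_nonpos_of_nonneg_of_nonpos (hf t ⟨ht.1.le, ht.2⟩) (hr t ht').le
      exact le_antisymm (hm (left_mem_Icc.mpr hT.le) ht ht.1)
        (h ▸ hm ht (right_mem_Icc.mpr hT.le) ht.2)
  intro t ht
  -- Derivatives within `Icc 0 T` are unique at the endpoints too, so f(T) = 0 is included although
  -- the sign of f is given only on [0, T).
  have h1 : HasDerivWithinAt F 0 (Icc 0 T) t :=
    (hasDerivWithinAt_const t (Icc 0 T) (F 0)).congr hconst (hconst t ht)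
  have h2 := (uniqueDiffOn_Icc hT t ht).eq_deriv _ (hF t ht) h1
  have hr0 : r t ≠ 0 := hr.elim (fun hr => (hr t ht).ne') (fun hr => (hr t ht).ne)
  exact (mul_eq_zero.mp h2).resolve_right hr0

/-- A periodic solution of `y' = p y + f r`, with `f ≥ 0` and `r` of one sign, has no zeros unless
`f = 0`. -/
theorem eq_zero_of_linear_of_zero (hT : 0 < T) {p y : ℝ → ℝ} (hp : ContinuousOn p (Icc 0 T))
    (hy : ∀ t ∈ Icc 0 T, HasDerivWithinAt y (p t * y t + f t * r t) (Icc 0 T) t)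
    (hf : ∀ t ∈ Ico 0 T, 0 ≤ f t)
    (hr : (∀ t ∈ Icc 0 T, 0 < r t) ∨ (∀ t ∈ Icc 0 T, r t < 0)) (h : y 0 = y T) {t₀ : ℝ}
    (ht₀ : t₀ ∈ Icc 0 T) (h₀ : y t₀ = 0) :
    ∀ t ∈ Icc 0 T, f t = 0 := by
  obtain ⟨P, hP⟩ := exists_integrating_factor ⟨le_rfl, hT.le⟩ hp
  have hz := hP y (fun t => f t * r t) hy
  set z : ℝ → ℝ := fun t => Real.exp (-P t) * y t with hzdef
  have hz' : ∀ t ∈ Icc 0 T, HasDerivWithinAt z (f t * (Real.exp (-P t) * r t)) (Icc 0 T) t :=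
    fun t ht => by convert! hz t ht using 1; ring
  have hc : ContinuousOn z (Icc 0 T) := fun t ht => (hz' t ht).continuousWithinAt
  have hd : ∀ t ∈ interior (Icc 0 T), HasDerivWithinAt z (f t * (Real.exp (-P t) * r t))
      (interior (Icc 0 T)) t :=
    fun t ht => (hz' t (interior_subset ht)).mono interior_subset
  have hr' : (∀ t ∈ Icc 0 T, 0 < Real.exp (-P t) * r t) ∨
      (∀ t ∈ Icc 0 T, Real.exp (-P t) * r t < 0) :=
    hr.imp (fun hr t ht => mul_pos (Real.exp_pos _) (hr t ht))
      (fun hr t ht => mul_neg_of_pos_of_neg (Real.exp_pos _) (hr t ht))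
  have hz₀ : z t₀ = 0 := by simp [hzdef, h₀]
  -- z is monotone and vanishes at t₀, so z(0) and z(T) have opposite weak signs. They are positive
  -- multiples of the same number y(0) = y(T), which is therefore 0.
  have hyz : y 0 = 0 := by
    rcases hr' with hr | hr
    · have hm : MonotoneOn z (Icc 0 T) := by
        refine monotoneOn_of_hasDerivWithinAt_nonneg (convex_Icc 0 T) hc hd fun t ht => ?_
        have ht' := interior_subset ht
        rw [interior_Icc] at ht
        exact mul_nonneg (hf t ⟨ht.1.le, ht.2⟩) (hr t ht').le
      have h1 := hm (left_mem_Icc.mpr hT.le) ht₀ ht₀.1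
      have h2 := hm ht₀ (right_mem_Icc.mpr hT.le) ht₀.2
      rw [hz₀] at h1 h2
      have h3 := nonpos_of_mul_nonpos_right h1 (Real.exp_pos _)
      have h4 := nonneg_of_mul_nonneg_right h2 (Real.exp_pos _)
      linarith
    · have hm : AntitoneOn z (Icc 0 T) := by
        refine antitoneOn_of_hasDerivWithinAt_nonpos (convex_Icc 0 T) hc hd fun t ht => ?_
        have ht' := interior_subset ht
        rw [interior_Icc] at ht
        exact mul_nonpos_of_nonneg_of_nonpos (hf t ⟨ht.1.le, ht.2⟩) (hr t ht').le
      have h1 := hm (left_mem_Icc.mpr hT.le) ht₀ ht₀.1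
      have h2 := hm ht₀ (right_mem_Icc.mpr hT.le) ht₀.2
      rw [hz₀] at h1 h2
      have h3 := nonneg_of_mul_nonneg_right h1 (Real.exp_pos _)
      have h4 := nonpos_of_mul_nonpos_right h2 (Real.exp_pos _)
      linarith
  exact eq_zero_of_hasDerivWithinAt_mul hT hz' hf hr' (by simp [hzdef, ← h, hyz])

end Monotonicity

/-! ### Centers and limit cycles when a combination of A and B keeps its sign. -/

namespace Abel

variable {T : ℝ} {A B a b : ℝ → ℝ}

/-- A combination of one sign with zero integral vanishes, so (A, B) = H'·(m, −l). Then x = y ∘ H,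
with y' = m y³ − l y², is closed because H(0) = H(T). -/
theorem isCenterAtZero_of_conditionD1 (hT : 0 < T)
    (ha : ∀ t ∈ Icc 0 T, HasDerivWithinAt a (A t) (Icc 0 T) t) (ha0 : a 0 = 0) (haT : a T = 0)
    (hb : ∀ t ∈ Icc 0 T, HasDerivWithinAt b (B t) (Icc 0 T) t) (hb0 : b 0 = 0) (hbT : b T = 0)
    {l m : ℝ} (hlm : (l, m) ≠ (0, 0)) (h : ∀ t ∈ Ico 0 T, 0 ≤ l * A t + m * B t) :
    IsCenterAtZero A B T := by
  have hz : ∀ t ∈ Icc 0 T, l * A t + m * B t = 0 :=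
    eq_zero_of_hasDerivWithinAt_mul (F := fun t => l * a t + m * b t) (r := fun _ => 1) hT
      (fun t ht => by simpa using ((ha t ht).const_mul l).fun_add ((hb t ht).const_mul m)) h
      (Or.inl fun _ _ => one_pos) (by simp [ha0, haT, hb0, hbT])
  have hN : l ^ 2 + m ^ 2 ≠ 0 := by
    intro h0
    exact hlm (Prod.ext (pow_eq_zero_iff two_ne_zero |>.mp (by nlinarith [sq_nonneg l, sq_nonneg m]))
      (pow_eq_zero_iff two_ne_zero |>.mp (by nlinarith [sq_nonneg l, sq_nonneg m])))
  set H : ℝ → ℝ := fun t => (m * a t - l * b t) / (l ^ 2 + m ^ 2) with hH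
  have hHd : ∀ t ∈ Icc 0 T, HasDerivWithinAt H ((m * A t - l * B t) / (l ^ 2 + m ^ 2))
      (Icc 0 T) t := fun t ht =>
    (((ha t ht).const_mul m).sub ((hb t ht).const_mul l)).div_const _
  obtain ⟨M, hM⟩ := isCompact_Icc.exists_bound_of_continuousOn
    (fun t ht => (hHd t ht).continuousWithinAt)
  have hmaps : MapsTo H (Icc 0 T) (Icc (-M) M) := fun t ht => abs_le.mp (hM t ht)
  have hH0 : H 0 = 0 := by simp [hH, ha0, hb0]
  have hHT : H T = 0 := by simp [hH, haT, hbT]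
  have h0 : (0 : ℝ) ∈ Icc (-M) M := hH0 ▸ hmaps (left_mem_Icc.mpr hT.le)
  obtain ⟨ε, hε, hsol⟩ := Metric.eventually_nhds_iff.mp
    (exists_small_solution (A := fun _ => m) (B := fun _ => -l) h0 continuousOn_const
      continuousOn_const)
  refine ⟨ε, hε, fun x₀ hx₀ => ?_⟩
  obtain ⟨y, hy0, hy⟩ := hsol (y := x₀) (by simpa using hx₀)
  refine ⟨y ∘ H, ⟨fun t ht => ?_, by simp [hH0, hHT]⟩, by simp [hH0, hy0]⟩
  convert! (hy (H t) (hmaps ht)).comp t (hHd t ht) hmaps using 1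
  have hA : A t = m * ((m * A t - l * B t) / (l ^ 2 + m ^ 2)) := by
    field_simp; linear_combination l * hz t ht
  have hB : B t = -l * ((m * A t - l * B t) / (l ^ 2 + m ^ 2)) := by
    field_simp; linear_combination m * hz t ht
  simp only [Function.comp_apply]
  linear_combination (y (H t)) ^ 3 * hA + (y (H t)) ^ 2 * hB

/-- If a nontrivial combination of `A` and `B` is nonnegative, `B` has mean zero and `A` has not,
then the zero solution is the only closed solution. -/
theorem IsClosedSolution.eq_zero_of_conditionD1 (hT : 0 < T) (hA : ContinuousOn A (Icc 0 T))
    (hB : ContinuousOn B (Icc 0 T))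
    (ha : ∀ t ∈ Icc 0 T, HasDerivWithinAt a (A t) (Icc 0 T) t) (ha0 : a 0 = 0) (haT : a T ≠ 0)
    (hb : ∀ t ∈ Icc 0 T, HasDerivWithinAt b (B t) (Icc 0 T) t) (hb0 : b 0 = 0) (hbT : b T = 0)
    {l m : ℝ} (hlm : (l, m) ≠ (0, 0)) (h : ∀ t ∈ Ico 0 T, 0 ≤ l * A t + m * B t)
    {x : ℝ → ℝ} (hx : IsClosedSolution A B T x) : ∀ t ∈ Icc 0 T, x t = 0 := by
  by_contra! hne
  obtain ⟨t₁, ht₁, hxt₁⟩ := hne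
  obtain ⟨hxs, hxT⟩ := hx
  have hxc := hxs.continuousOn
  have hx0 : ∀ t ∈ Icc 0 T, x t ≠ 0 := fun t ht h0 =>
    hxt₁ (hxs.eqOn hT.le hA hB isSolution_zero ht h0 ht₁)
  rcases eq_or_ne l 0 with rfl | hl
  -- Here B = 0 and the equation is of Bernoulli type: 1/x² decreases by 2a(T) ≠ 0 over [0, T], so x
  -- is not closed.
  · have hm : m ≠ 0 := fun h => hlm (by rw [h])
    have hB0 : ∀ t ∈ Icc 0 T, 0 * A t + m * B t = 0 :=
      eq_zero_of_hasDerivWithinAt_mul (F := fun t => m * b t) (r := fun _ => 1) hT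
        (fun t ht => by simpa using (hb t ht).const_mul m) h
        (Or.inl fun _ _ => one_pos) (by simp [hb0, hbT])
    have h1 : ∀ t ∈ Icc 0 T, HasDerivWithinAt (fun t => (x t ^ 2)⁻¹) (-2 * A t) (Icc 0 T) t := by
      intro t ht
      have hBt : B t = 0 := by simpa [hm] using hB0 t ht
      convert! ((hxs t ht).pow 2).inv (pow_ne_zero 2 (hx0 t ht)) using 1
      have := hx0 t ht
      rw [hBt]
      simp only [Pi.pow_apply]
      field_simp
      ring
    have h2 := eqOn_Icc_of_hasDerivWithinAt (t₀ := 0) ⟨le_rfl, hT.le⟩ h1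
      (g := fun t => (x 0 ^ 2)⁻¹ - 2 * a t)
      (fun t ht => by simpa using ((ha t ht).const_mul 2).const_sub ((x 0 ^ 2)⁻¹))
      (by simp [ha0]) (right_mem_Icc.mpr hT.le)
    simp only [hxT] at h2
    exact haT (by linarith)
  · have hfne : ¬ ∀ t ∈ Icc 0 T, l * A t + m * B t = 0 := by
      intro hz
      have := eqOn_Icc_of_hasDerivWithinAt (t₀ := 0) ⟨le_rfl, hT.le⟩
        (f := fun t => l * a t + m * b t) (f' := fun _ => 0) (g := fun _ => 0)
        (fun t ht => by
          have := ((ha t ht).const_mul l).fun_add ((hb t ht).const_mul m)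
          rwa [hz t ht] at this)
        (fun t _ => hasDerivWithinAt_const _ _ _) (by simp [ha0, hb0]) (right_mem_Icc.mpr hT.le)
      simp [hbT, hl, haT] at this
    -- The line x = l/m is crossed in one direction only: with f = lA + mB, the function y = l − m x
    -- satisfies y' = −(m/l)B x² y − (m/l)f x³, and x keeps its sign. So a closed solution cannot
    -- meet it.
    have hy0 : ∀ t ∈ Icc 0 T, l - m * x t ≠ 0 := by
      intro t ht hyt
      rcases eq_or_ne m 0 with rfl | hm
      · simp [hl] at hyt
      refine hfne (eq_zero_of_linear_of_zero (y := fun t => l - m * x t)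
        (p := fun t => -(m / l) * (B t * x t ^ 2)) (r := fun t => -(m / l) * x t ^ 3) hT
        (by fun_prop) (fun t ht => ?_) h (pos_or_neg_of_ne_zero isPreconnected_Icc (by fun_prop)
          fun t ht => ?_) (by simp [hxT]) ht hyt)
      · convert! ((hxs t ht).const_mul m).const_sub l using 1
        field_simp
        ring
      · exact mul_ne_zero (neg_ne_zero.mpr (div_ne_zero hm hl)) (pow_ne_zero _ (hx0 t ht))
    -- The terms in x form a primitive of dx/(x²(l − m x)), by partial fractions; subtracting b/l
    -- leaves the derivative f·x/(l(l − m x)). `Real.log` is log|·|, so the signs of x and l − m x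
    -- do not matter.
    refine hfne (eq_zero_of_hasDerivWithinAt_mul
      (F := fun t => -(l * x t)⁻¹ + m / l ^ 2 * Real.log (x t) -
        m / l ^ 2 * Real.log (l - m * x t) - b t / l)
      (r := fun t => x t / (l * (l - m * x t))) hT (fun t ht => ?_) h
      (pos_or_neg_of_ne_zero isPreconnected_Icc ?_ fun t ht => ?_) (by simp [hxT, hb0, hbT]))
    · have e0 := hx0 t ht
      have e1 := hy0 t ht
      have hd := hxs t ht
      convert! (((((hd.const_mul l).fun_inv (mul_ne_zero hl e0)).fun_neg).fun_add
        ((hd.log e0).const_mul (m / l ^ 2))).fun_sub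
        ((((hd.const_mul m).const_sub l).log e1).const_mul (m / l ^ 2))).fun_sub
        ((hb t ht).div_const l) using 1
      field_simp
      ring
    · exact hxc.div (by fun_prop) fun t ht => mul_ne_zero hl (hy0 t ht)
    · exact div_ne_zero (hx0 t ht) (mul_ne_zero hl (hy0 t ht))

end Abel

/-! ### The signed area of the closed curve (a, b). -/

/-- A product of two functions vanishing at `t` has, near `t`, the sign of the product of their
derivatives at `t`. -/
theorem eventually_mul_pos_of_hasDerivAt {f g : ℝ → ℝ} {f' g' t c : ℝ} (hf : HasDerivAt f f' t)
    (hg : HasDerivAt g g' t) (hf0 : f t = 0) (hg0 : g t = 0) (h : 0 < c * (f' * g')) :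
    ∀ᶠ u in 𝓝[≠] t, 0 < c * (f u * g u) := by
  have h1 := ((hasDerivAt_iff_tendsto_slope.mp hf).mul
    (hasDerivAt_iff_tendsto_slope.mp hg)).const_mul c
  filter_upwards [h1.eventually_const_lt h, self_mem_nhdsWithin] with u hu hne
  have hne' : u - t ≠ 0 := sub_ne_zero.mpr hne
  rw [slope_def_field, slope_def_field, hf0, hg0, sub_zero, sub_zero] at hu
  have h2 := mul_pos hu (pow_pos (abs_pos.mpr hne') 2)
  rw [sq_abs] at h2
  have e : c * (f u * g u) = c * (f u / (u - t) * (g u / (u - t))) * (u - t) ^ 2 := by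
    field_simp
  rwa [e]

namespace Abel

variable {T : ℝ} {A B a b k : ℝ → ℝ}

/-- If `(A, B)` turns counterclockwise and no nontrivial combination of `A` and `B` has three zeros,
then the closed curve `(a, b)` encloses a positive area. -/
theorem primitive_neg_of_wronskian_pos (hT : 0 < T) (hA : ContinuousOn A (Icc 0 T))
    (hB : ContinuousOn B (Icc 0 T))
    (ha : ∀ t ∈ Icc 0 T, HasDerivWithinAt a (A t) (Icc 0 T) t) (ha0 : a 0 = 0) (haT : a T = 0)
    (hb : ∀ t ∈ Icc 0 T, HasDerivWithinAt b (B t) (Icc 0 T) t) (hb0 : b 0 = 0) (hbT : b T = 0)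
    (hk : ∀ t ∈ Icc 0 T, HasDerivWithinAt k (A t * b t) (Icc 0 T) t) (hk0 : k 0 = 0)
    (hdA : ∀ t ∈ Ioo 0 T, DifferentiableAt ℝ A t) (hdB : ∀ t ∈ Ioo 0 T, DifferentiableAt ℝ B t)
    (hW : ∀ t ∈ Ioo 0 T, 0 < A t * deriv B t - deriv A t * B t)
    (hAB : (A 0, B 0) ≠ (0, 0))
    (hZ : ∀ l m : ℝ, (l, m) ≠ (0, 0) → ∀ t₁ t₂ t₃, 0 ≤ t₁ → t₁ < t₂ → t₂ < t₃ → t₃ < T →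
      l * A t₁ + m * B t₁ = 0 → l * A t₂ + m * B t₂ = 0 → l * A t₃ + m * B t₃ = 0 → False) :
    k T < 0 := by
  have rolle : ∀ l m u v : ℝ, 0 ≤ u → u < v → v ≤ T → l * a u + m * b u = 0 →
      l * a v + m * b v = 0 → ∃ w, u < w ∧ w < v ∧ l * A w + m * B w = 0 := by
    intro l m u v hu huv hv h1 h2
    have hd : ∀ t ∈ Icc 0 T, HasDerivWithinAt (fun t => l * a t + m * b t) (l * A t + m * B t)
        (Icc 0 T) t := fun t ht => ((ha t ht).const_mul l).fun_add ((hb t ht).const_mul m)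
    obtain ⟨w, hw, hw0⟩ := exists_hasDerivAt_eq_zero huv
      (fun t ht => ((hd t ⟨hu.trans ht.1, ht.2.trans hv⟩).mono
        (Icc_subset_Icc hu hv)).continuousWithinAt) (h1.trans h2.symm)
      (fun t ht => (hd t ⟨hu.trans ht.1.le, ht.2.le.trans hv⟩).hasDerivAt
        (Icc_mem_nhds (hu.trans_lt ht.1) (ht.2.trans_le hv)))
    exact ⟨w, hw.1, hw.2, hw0⟩
  have hne₁ : (-B 0, A 0) ≠ (0, 0) := by
    intro h; apply hAB; simp only [Prod.mk.injEq, neg_eq_zero] at h ⊢; exact ⟨h.2, h.1⟩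
  -- At τ the tangent of (a, b) is parallel to the tangent at time 0. D ≠ 0 says that the point at
  -- time τ is off the initial tangent line.
  obtain ⟨τ, hτ0, hτT, hτ⟩ := rolle (-B 0) (A 0) 0 T le_rfl hT le_rfl (by simp [ha0, hb0])
    (by simp [haT, hbT])
  have hB0 : -B 0 * A 0 + A 0 * B 0 = 0 := by ring
  set D := -B 0 * a τ + A 0 * b τ with hD
  have hD0 : D ≠ 0 := by
    intro h
    obtain ⟨w, hw0, hwτ, hw⟩ := rolle (-B 0) (A 0) 0 τ le_rfl hτ0 hτT.le (by simp [ha0, hb0]) h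
    exact hZ _ _ hne₁ 0 w τ le_rfl hw0 hwτ hτT hB0 hw hτ
  have hne₂ : (b τ, -a τ) ≠ (0, 0) := by
    intro h; apply hD0; simp only [Prod.mk.injEq, neg_eq_zero] at h; simp [hD, h.1, h.2]
  have haτ : b τ * a τ + -a τ * b τ = 0 := by ring
  have hmem : τ ∈ Ioo 0 T := ⟨hτ0, hτT⟩
  -- the factors of the derivative of the area function have no zeros besides `0`, `τ` and `T`
  have hBne : ∀ t, 0 < t → t < T → t ≠ τ → -B 0 * A t + A 0 * B t ≠ 0 := by
    intro t ht0 htT hne h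
    rcases hne.lt_or_gt with hlt | hlt
    · exact hZ _ _ hne₁ 0 t τ le_rfl ht0 hlt hτT hB0 h hτ
    · exact hZ _ _ hne₁ 0 τ t le_rfl hτ0 hlt htT hB0 hτ h
  have hane : ∀ t, 0 < t → t < T → t ≠ τ → b τ * a t + -a τ * b t ≠ 0 := by
    intro t ht0 htT hne h
    have e0 : b τ * a 0 + -a τ * b 0 = 0 := by simp [ha0, hb0]
    have eT : b τ * a T + -a τ * b T = 0 := by simp [haT, hbT]
    rcases hne.lt_or_gt with hlt | hlt
    · obtain ⟨u, hu⟩ := rolle _ _ 0 t le_rfl ht0 htT.le e0 h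
      obtain ⟨v, hv⟩ := rolle _ _ t τ ht0.le hlt hτT.le h haτ
      obtain ⟨w, hw⟩ := rolle _ _ τ T hτ0.le hτT le_rfl haτ eT
      exact hZ _ _ hne₂ u v w hu.1.le (hu.2.1.trans hv.1) (hv.2.1.trans hw.1) hw.2.1
        hu.2.2 hv.2.2 hw.2.2
    · obtain ⟨u, hu⟩ := rolle _ _ 0 τ le_rfl hτ0 hτT.le e0 haτ
      obtain ⟨v, hv⟩ := rolle _ _ τ t hτ0.le hlt htT.le haτ h
      obtain ⟨w, hw⟩ := rolle _ _ t T ht0.le htT le_rfl h eT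
      exact hZ _ _ hne₂ u v w hu.1.le (hu.2.1.trans hv.1) (hv.2.1.trans hw.1) hw.2.1
        hu.2.2 hv.2.2 hw.2.2
  -- One factor vanishes where the curve meets the chord from time 0 to τ, the other where its
  -- tangent is parallel to the initial one. In (0, T) both vanish only at τ, where they change sign
  -- together; the factor D makes the product positive.
  set g : ℝ → ℝ := fun t => D * ((b τ * a t + -a τ * b t) * (-B 0 * A t + A 0 * B t)) with hg
  have hac : ContinuousOn a (Icc 0 T) := fun t ht => (ha t ht).continuousWithinAt
  have hbc : ContinuousOn b (Icc 0 T) := fun t ht => (hb t ht).continuousWithinAt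
  have hgc : ContinuousOn g (Icc 0 T) := by fun_prop
  have hgne : ∀ t, 0 < t → t < T → t ≠ τ → g t ≠ 0 := fun t h1 h2 h3 =>
    mul_ne_zero hD0 (mul_ne_zero (hane t h1 h2 h3) (hBne t h1 h2 h3))
  have hnear : ∀ᶠ t in 𝓝[≠] τ, 0 < g t := by
    have hn := Icc_mem_nhds hτ0 hτT
    have hIcc : τ ∈ Icc 0 T := ⟨hτ0.le, hτT.le⟩
    have d1 := (((ha τ hIcc).hasDerivAt hn).const_mul (b τ)).fun_add
      (((hb τ hIcc).hasDerivAt hn).const_mul (-a τ))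
    have d2 := ((hdA τ hmem).hasDerivAt.const_mul (-B 0)).fun_add
      ((hdB τ hmem).hasDerivAt.const_mul (A 0))
    refine eventually_mul_pos_of_hasDerivAt d1 d2 haτ hτ ?_
    have : D * ((b τ * A τ + -a τ * B τ) * (-B 0 * deriv A τ + A 0 * deriv B τ)) =
        D ^ 2 * (A τ * deriv B τ - deriv A τ * B τ) := by
      rw [hD]
      linear_combination
        (-B 0 * a τ + A 0 * b τ) * (b τ * deriv A τ - a τ * deriv B τ) * hτ
    rw [this]
    exact mul_pos (by positivity) (hW τ hmem)
  have hleft : ∀ t ∈ Ioo 0 τ, 0 < g t := by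
    refine (pos_or_neg_of_ne_zero isPreconnected_Ioo
      (hgc.mono fun t ht => ⟨ht.1.le, (ht.2.trans hτT).le⟩)
      fun t ht => hgne t ht.1 (ht.2.trans hτT) ht.2.ne).resolve_right fun hneg => ?_
    have h1 : ∀ᶠ t in 𝓝[<] τ, 0 < g t := hnear.filter_mono (nhdsWithin_mono _ fun t ht => ht.ne)
    obtain ⟨t, ht, htm⟩ := (h1.and (Ioo_mem_nhdsLT hτ0)).exists
    exact absurd ht (hneg t htm).not_gt
  have hright : ∀ t ∈ Ioo τ T, 0 < g t := by
    refine (pos_or_neg_of_ne_zero isPreconnected_Ioo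
      (hgc.mono fun t ht => ⟨(hτ0.trans ht.1).le, ht.2.le⟩)
      fun t ht => hgne t (hτ0.trans ht.1) ht.2 ht.1.ne').resolve_right fun hneg => ?_
    have h1 : ∀ᶠ t in 𝓝[>] τ, 0 < g t := hnear.filter_mono (nhdsWithin_mono _ fun t ht => ht.ne')
    obtain ⟨t, ht, htm⟩ := (h1.and (Ioo_mem_nhdsGT hτT)).exists
    exact absurd ht (hneg t htm).not_gt
  -- A primitive of g, using ab − k as primitive of aB. On the closed curve the exact terms a²/2,
  -- b²/2, ab drop out, leaving G(T) = −D²k(T).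
  set G : ℝ → ℝ := fun t => D * (b τ * (-B 0 * (a t ^ 2 / 2) + A 0 * (a t * b t - k t)) -
    a τ * (-B 0 * k t + A 0 * (b t ^ 2 / 2))) with hG
  have hGd : ∀ t ∈ Icc 0 T, HasDerivWithinAt G (g t) (Icc 0 T) t := by
    intro t ht
    have da := ha t ht
    have db := hb t ht
    have dk := hk t ht
    convert! ((((((da.fun_pow 2).div_const 2).const_mul (-B 0)).fun_add
      (((da.fun_mul db).fun_sub dk).const_mul (A 0))).const_mul (b τ)).fun_sub
      (((dk.const_mul (-B 0)).fun_add
        (((db.fun_pow 2).div_const 2).const_mul (A 0))).const_mul (a τ))).const_mul D using 1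
    simp only [hg]
    push_cast
    ring
  have hGmono : ∀ u v, 0 ≤ u → u < v → v ≤ T → (∀ t ∈ Ioo u v, 0 < g t) → G u < G v := by
    intro u v hu huv hv hpos
    have hsub : Icc u v ⊆ Icc 0 T := Icc_subset_Icc hu hv
    have := strictMonoOn_of_hasDerivWithinAt_pos (convex_Icc u v)
      (fun t ht => ((hGd t (hsub ht)).mono hsub).continuousWithinAt)
      (fun t ht => (hGd t (hsub (interior_subset ht))).mono (interior_subset.trans hsub))
      (fun t ht => hpos t (by rwa [interior_Icc] at ht))
    exact this (left_mem_Icc.mpr huv.le) (right_mem_Icc.mpr huv.le) huv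
  have h1 := (hGmono 0 τ le_rfl hτ0 hτT.le hleft).trans (hGmono τ T hτ0.le hτT le_rfl hright)
  have h2 : G T = -(D ^ 2 * k T) := by simp only [hG, haT, hbT, hD]; ring
  have h3 : G 0 = 0 := by simp [hG, ha0, hb0, hk0]
  rw [h2, h3, Left.neg_pos_iff] at h1
  exact (pos_iff_neg_of_mul_neg h1).mp (by positivity)

end Abel

/-! ### Double zeros and Chebyshev systems. -/

/-- A function on `[0, T)` whose only zero is a local minimum is nonnegative. -/
theorem nonneg_of_isLocalMin {T t₀ : ℝ} (ht₀ : t₀ ∈ Ioo 0 T) {f : ℝ → ℝ}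
    (hf : ContinuousOn f (Ico 0 T)) (h0 : f t₀ = 0) (hne : ∀ t ∈ Ico 0 T, t ≠ t₀ → f t ≠ 0)
    (hmin : IsLocalMin f t₀) : ∀ t ∈ Ico 0 T, 0 ≤ f t := by
  have hmin' : ∀ᶠ t in 𝓝 t₀, 0 ≤ f t := by simpa [IsLocalMin, IsMinFilter, h0] using hmin
  have hleft : ∀ t ∈ Ico 0 t₀, 0 < f t := by
    refine (pos_or_neg_of_ne_zero isPreconnected_Ico
      (hf.mono (Ico_subset_Ico_right ht₀.2.le))
      fun t ht => hne t ⟨ht.1, ht.2.trans ht₀.2⟩ ht.2.ne).resolve_right fun hneg => ?_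
    have h1 : ∀ᶠ t in 𝓝[<] t₀, 0 ≤ f t := hmin'.filter_mono nhdsWithin_le_nhds
    obtain ⟨t, ht, htm⟩ := (h1.and (Ico_mem_nhdsLT ht₀.1)).exists
    exact absurd (hneg t htm) ht.not_gt
  have hright : ∀ t ∈ Ioo t₀ T, 0 < f t := by
    refine (pos_or_neg_of_ne_zero isPreconnected_Ioo
      (hf.mono fun t ht => ⟨(ht₀.1.trans ht.1).le, ht.2⟩)
      fun t ht => hne t ⟨(ht₀.1.trans ht.1).le, ht.2⟩ ht.1.ne').resolve_right fun hneg => ?_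
    have h1 : ∀ᶠ t in 𝓝[>] t₀, 0 ≤ f t := hmin'.filter_mono nhdsWithin_le_nhds
    obtain ⟨t, ht, htm⟩ := (h1.and (Ioo_mem_nhdsGT ht₀.2)).exists
    exact absurd (hneg t htm) ht.not_gt
  intro t ht
  rcases lt_trichotomy t t₀ with h | rfl | h
  · exact (hleft t ⟨ht.1, h⟩).le
  · exact h0.ge
  · exact (hright t ⟨h, ht.2⟩).le

/-- A `C²` function on `[0, T)` with a double zero and at most two zeros, counted with
multiplicities, has constant sign. -/
theorem nonneg_or_nonpos_of_double_zero {T t₀ : ℝ} (ht₀ : t₀ ∈ Ico 0 T) {f : ℝ → ℝ}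
    (hf : ContDiffOn ℝ 2 f (Ico 0 T)) (hz : AtMostZerosOn f (Ico 0 T) 2) (h0 : f t₀ = 0)
    (h1 : derivWithin f (Ico 0 T) t₀ = 0) :
    (∀ t ∈ Ico 0 T, 0 ≤ f t) ∨ (∀ t ∈ Ico 0 T, f t ≤ 0) := by
  have hj : ∀ j < 2, iteratedDerivWithin j f (Ico 0 T) t₀ = 0 := by
    intro j hj
    interval_cases j
    · simpa using h0
    · simpa using h1
  have hne : ∀ t ∈ Ico 0 T, t ≠ t₀ → f t ≠ 0 := by
    intro t ht htne hft
    have := hz {t₀, t} (fun u => if u = t₀ then 2 else 1)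
      (by simp only [Finset.mem_insert, Finset.mem_singleton]; rintro u (rfl | rfl) <;> assumption)
      (by
        simp only [Finset.mem_insert, Finset.mem_singleton]
        rintro u (rfl | rfl) j hju
        · exact hj j (by simpa using hju)
        · rw [if_neg htne, Nat.lt_one_iff] at hju
          simpa [hju] using hft)
    rw [Finset.sum_pair htne.symm, if_pos rfl, if_neg htne] at this
    omega
  -- At the endpoint 0 the absence of other zeros suffices. At an interior point the second
  -- derivative is nonzero, since a triple zero is excluded, so t₀ is a strict extremum.
  rcases ht₀.1.eq_or_lt with rfl | hpos
  · rcases pos_or_neg_of_ne_zero isPreconnected_Ioo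
      (hf.continuousOn.mono Ioo_subset_Ico_self)
      (fun t ht => hne t (Ioo_subset_Ico_self ht) ht.1.ne') with h | h
    · refine Or.inl fun t ht => ?_
      rcases ht.1.eq_or_lt with rfl | h'
      exacts [h0.ge, (h t ⟨h', ht.2⟩).le]
    · refine Or.inr fun t ht => ?_
      rcases ht.1.eq_or_lt with rfl | h'
      exacts [h0.le, (h t ⟨h', ht.2⟩).le]
  · have hI : Ico 0 T ∈ 𝓝 t₀ := Ico_mem_nhds hpos ht₀.2
    have hat : ContDiffAt ℝ 2 f t₀ := hf.contDiffAt hI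
    have hd1 : deriv f t₀ = 0 := by rwa [derivWithin_of_mem_nhds hI] at h1
    have hd2 : deriv (deriv f) t₀ ≠ 0 := by
      intro h2
      have := hz {t₀} (fun _ => 3) (by simpa using ht₀) (by
        simp only [Finset.mem_singleton]
        rintro u rfl j hj3
        rcases Nat.lt_succ_iff_lt_or_eq.mp hj3 with hj2 | rfl
        · exact hj j hj2
        · rw [iteratedDerivWithin_eq_iteratedDeriv (uniqueDiffOn_Ico 0 T) hat ht₀,
            iteratedDeriv_succ, iteratedDeriv_one, h2])
      simp at this
    rcases hd2.lt_or_gt with hlt | hlt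
    · right
      have hneg := nonneg_of_isLocalMin (f := fun t => -f t) ⟨hpos, ht₀.2⟩ hf.continuousOn.neg
        (by simp [h0]) (fun t ht h => neg_ne_zero.mpr (hne t ht h))
        (isLocalMax_of_deriv_deriv_neg hlt hd1 hat.continuousAt).neg
      exact fun t ht => neg_nonneg.mp (hneg t ht)
    · exact Or.inl (nonneg_of_isLocalMin ⟨hpos, ht₀.2⟩ hf.continuousOn h0 hne
        (isLocalMin_of_deriv_deriv_pos hlt hd1 hat.continuousAt))

section Chebyshev

variable {T : ℝ} {A B : ℝ → ℝ}

theorem IsETSystemWithAccuracy.contDiffOn_pair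
    (h : IsETSystemWithAccuracy 1 ![A, B] (Ico 0 T)) :
    ContDiffOn ℝ 2 A (Ico 0 T) ∧ ContDiffOn ℝ 2 B (Ico 0 T) :=
  ⟨by simpa [one_add_one_eq_two] using h.1 0, by simpa [one_add_one_eq_two] using h.1 1⟩

theorem IsETSystemWithAccuracy.atMostZerosOn_pair
    (h : IsETSystemWithAccuracy 1 ![A, B] (Ico 0 T)) {l m : ℝ}
    (hne : ∃ t ∈ Ico 0 T, l * A t + m * B t ≠ 0) :
    AtMostZerosOn (fun t => l * A t + m * B t) (Ico 0 T) 2 := by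
  have e : ∀ t, ∑ i : Fin (1 + 1), ![l, m] i * ![A, B] i t = l * A t + m * B t :=
    fun t => Fin.sum_univ_two _
  have := h.2 ![l, m]
  simp only [e] at this
  exact this hne

theorem derivWithin_combination (h : IsETSystemWithAccuracy 1 ![A, B] (Ico 0 T)) (l m : ℝ) {t : ℝ}
    (ht : t ∈ Ico 0 T) :
    derivWithin (fun t => l * A t + m * B t) (Ico 0 T) t =
      l * derivWithin A (Ico 0 T) t + m * derivWithin B (Ico 0 T) t := by
  have hA := (h.contDiffOn_pair.1.differentiableOn two_ne_zero t ht).hasDerivWithinAt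
  have hB := (h.contDiffOn_pair.2.differentiableOn two_ne_zero t ht).hasDerivWithinAt
  exact ((hA.const_mul l).fun_add (hB.const_mul m)).derivWithin (uniqueDiffOn_Ico 0 T t ht)

/-- An extended Chebyshev system with accuracy one satisfies one of the two conditions. -/
theorem IsETSystemWithAccuracy.conditionD1_or_conditionD2
    (h : IsETSystemWithAccuracy 1 ![A, B] (Ico 0 T)) :
    ConditionD1 A B (Ico 0 T) ∨ ConditionD2 A B (Ico 0 T) := by
  obtain ⟨hA, hB⟩ := h.contDiffOn_pair
  by_cases hW : ∀ t ∈ Ico 0 T,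
      A t * derivWithin B (Ico 0 T) t - derivWithin A (Ico 0 T) t * B t ≠ 0
  · right
    have hA' := hA.continuousOn_derivWithin (uniqueDiffOn_Ico 0 T) one_le_two
    have hB' := hB.continuousOn_derivWithin (uniqueDiffOn_Ico 0 T) one_le_two
    exact pos_or_neg_of_ne_zero isPreconnected_Ico
      ((hA.continuousOn.mul hB').sub (hA'.mul hB.continuousOn)) hW
  · left
    push Not at hW
    obtain ⟨t₀, ht₀, hW⟩ := hW
    -- A nontrivial kernel vector of the singular matrix with rows (A, B) and (A', B') at t₀.
    obtain ⟨l, m, hlm, h0, h1⟩ : ∃ l m : ℝ, (l, m) ≠ (0, 0) ∧ l * A t₀ + m * B t₀ = 0 ∧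
        l * derivWithin A (Ico 0 T) t₀ + m * derivWithin B (Ico 0 T) t₀ = 0 := by
      by_cases hAB : A t₀ = 0 ∧ B t₀ = 0
      · by_cases hAB' : derivWithin A (Ico 0 T) t₀ = 0 ∧ derivWithin B (Ico 0 T) t₀ = 0
        · exact ⟨1, 0, by simp, by simp [hAB], by simp [hAB']⟩
        · refine ⟨derivWithin B (Ico 0 T) t₀, -derivWithin A (Ico 0 T) t₀, ?_, by simp [hAB],
            by ring⟩
          intro he
          simp only [Prod.mk.injEq, neg_eq_zero] at he
          exact hAB' he.symm
      · refine ⟨-B t₀, A t₀, ?_, by ring, by linear_combination hW⟩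
        intro he
        simp only [Prod.mk.injEq, neg_eq_zero] at he
        exact hAB he.symm
    refine ⟨l, m, hlm, ?_⟩
    by_cases hne : ∃ t ∈ Ico 0 T, l * A t + m * B t ≠ 0
    · exact nonneg_or_nonpos_of_double_zero ht₀
        ((contDiffOn_const.mul hA).add (contDiffOn_const.mul hB)) (h.atMostZerosOn_pair hne) h0
        (by rw [derivWithin_combination h l m ht₀, h1])
    · push Not at hne
      exact Or.inl fun t ht => (hne t ht).ge

/-- With a nonvanishing Wronskian, no nontrivial combination has three zeros. -/
theorem IsETSystemWithAccuracy.not_three_zeros (h : IsETSystemWithAccuracy 1 ![A, B] (Ico 0 T))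
    (hW : A 0 * derivWithin B (Ico 0 T) 0 - derivWithin A (Ico 0 T) 0 * B 0 ≠ 0) {l m : ℝ}
    (hlm : (l, m) ≠ (0, 0)) {t₁ t₂ t₃ : ℝ} (ht₁ : 0 ≤ t₁) (h₁₂ : t₁ < t₂) (h₂₃ : t₂ < t₃)
    (ht₃ : t₃ < T) (hz₁ : l * A t₁ + m * B t₁ = 0) (hz₂ : l * A t₂ + m * B t₂ = 0)
    (hz₃ : l * A t₃ + m * B t₃ = 0) : False := by
  by_cases hne : ∃ t ∈ Ico 0 T, l * A t + m * B t ≠ 0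
  · have := h.atMostZerosOn_pair hne {t₁, t₂, t₃} (fun _ => 1)
      (by
        simp only [Finset.mem_insert, Finset.mem_singleton]
        rintro t (rfl | rfl | rfl) <;> constructor <;> linarith)
      (by
        simp only [Finset.mem_insert, Finset.mem_singleton]
        rintro t (rfl | rfl | rfl) j hj <;> rw [Nat.lt_one_iff.mp hj] <;> simpa)
    rw [Finset.sum_const, smul_eq_mul, mul_one, Finset.card_eq_three.mpr
      ⟨t₁, t₂, t₃, h₁₂.ne, (h₁₂.trans h₂₃).ne, h₂₃.ne, rfl⟩] at this
    omega
  · push Not at hne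
    -- The zero bound excludes identically zero combinations; here the nonzero Wronskian at 0 rules
    -- them out.
    have h0 : (0 : ℝ) ∈ Ico 0 T := ⟨le_rfl, by linarith⟩
    have e0 := hne 0 h0
    have e1 := derivWithin_combination h l m h0
    rw [derivWithin_congr (f := fun _ => (0 : ℝ)) hne e0, derivWithin_fun_const] at e1
    simp only [Pi.zero_apply] at e1
    apply hlm
    have hl : l * (A 0 * derivWithin B (Ico 0 T) 0 - derivWithin A (Ico 0 T) 0 * B 0) = 0 := by
      linear_combination derivWithin B (Ico 0 T) 0 * e0 + B 0 * e1
    have hm : m * (A 0 * derivWithin B (Ico 0 T) 0 - derivWithin A (Ico 0 T) 0 * B 0) = 0 := by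
      linear_combination -derivWithin A (Ico 0 T) 0 * e0 - A 0 * e1
    exact Prod.ext ((mul_eq_zero.mp hl).resolve_right hW) ((mul_eq_zero.mp hm).resolve_right hW)

namespace Abel

variable {a b k : ℝ → ℝ}

/-- The sign of the enclosed area is that of the Wronskian. -/
theorem primitive_sign_of_wronskian (hT : 0 < T) (hA : ContinuousOn A (Icc 0 T))
    (hB : ContinuousOn B (Icc 0 T)) (h : IsETSystemWithAccuracy 1 ![A, B] (Ico 0 T))
    (ha : ∀ t ∈ Icc 0 T, HasDerivWithinAt a (A t) (Icc 0 T) t) (ha0 : a 0 = 0) (haT : a T = 0)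
    (hb : ∀ t ∈ Icc 0 T, HasDerivWithinAt b (B t) (Icc 0 T) t) (hb0 : b 0 = 0) (hbT : b T = 0)
    (hk : ∀ t ∈ Icc 0 T, HasDerivWithinAt k (A t * b t) (Icc 0 T) t) (hk0 : k 0 = 0) :
    ((∀ t ∈ Ico 0 T, 0 < A t * derivWithin B (Ico 0 T) t - derivWithin A (Ico 0 T) t * B t) →
      k T < 0) ∧
    ((∀ t ∈ Ico 0 T, A t * derivWithin B (Ico 0 T) t - derivWithin A (Ico 0 T) t * B t < 0) →
      0 < k T) := by
  have hnhds : ∀ t ∈ Ioo 0 T, Ico 0 T ∈ 𝓝 t := fun t ht => Ico_mem_nhds ht.1 ht.2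
  have hdA : ∀ t ∈ Ioo 0 T, DifferentiableAt ℝ A t := fun t ht =>
    (h.contDiffOn_pair.1.contDiffAt (hnhds t ht)).differentiableAt two_ne_zero
  have hdB : ∀ t ∈ Ioo 0 T, DifferentiableAt ℝ B t := fun t ht =>
    (h.contDiffOn_pair.2.contDiffAt (hnhds t ht)).differentiableAt two_ne_zero
  have h0 : (0 : ℝ) ∈ Ico 0 T := ⟨le_rfl, hT⟩
  constructor
  · intro hW
    refine primitive_neg_of_wronskian_pos hT hA hB ha ha0 haT hb hb0 hbT hk hk0 hdA hdB
      (fun t ht => ?_) ?_ fun l m hlm t₁ t₂ t₃ => h.not_three_zeros (hW 0 h0).ne' hlm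
    · have := hW t (Ioo_subset_Ico_self ht)
      rwa [derivWithin_of_mem_nhds (hnhds t ht), derivWithin_of_mem_nhds (hnhds t ht)] at this
    · intro he
      have := hW 0 h0
      simp only [Prod.mk.injEq] at he
      simp [he.1, he.2] at this
  · intro hW
    -- Replacing A by −A reverses the signs of both the Wronskian and the area.
    have := primitive_neg_of_wronskian_pos (A := fun t => -A t) (a := fun t => -a t)
      (k := fun t => -k t) hT hA.neg hB (fun t ht => (ha t ht).fun_neg)
      (by simp [ha0]) (by simp [haT]) hb hb0 hbT
      (fun t ht => by simpa using (hk t ht).fun_neg) (by simp [hk0])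
      (fun t ht => (hdA t ht).fun_neg) hdB
      (fun t ht => ?_) ?_ fun l m hlm t₁ t₂ t₃ h₁ h₁₂ h₂₃ h₃ z₁ z₂ z₃ =>
        h.not_three_zeros (hW 0 h0).ne (l := -l) (m := m) (by simpa using hlm) h₁ h₁₂ h₂₃ h₃
          (by linarith) (by linarith) (by linarith)
    · exact neg_neg_iff_pos.mp this
    · have := hW t (Ioo_subset_Ico_self ht)
      rw [derivWithin_of_mem_nhds (hnhds t ht), derivWithin_of_mem_nhds (hnhds t ht)] at this
      rw [deriv.fun_neg]
      linarith
    · intro he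
      have := hW 0 h0
      simp only [Prod.mk.injEq, neg_eq_zero] at he
      simp [he.1, he.2] at this

end Abel

end Chebyshev

/-! ### The main theorem. -/

theorem mainTheorem6 (T : ℝ) (hT : 0 < T) (A B : ℝ → ℝ)
    (hA : ContinuousOn A (Set.Icc 0 T)) (hB : ContinuousOn B (Set.Icc 0 T))
    (hET : IsETSystemWithAccuracy 1 ![A, B] (Set.Ico 0 T)) :
    -- the Lyapunov constants are the coefficients of a convergent expansion of the displacement
    (∃ r > 0, ∀ x₀ : ℝ, |x₀| < r →
      (∃ x, Abel.IsSolution A B T x ∧ x 0 = x₀) ∧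
      HasSum (fun i : ℕ => Abel.lyapunovConstant A B T (i + 2) * x₀ ^ (i + 2))
        (Abel.displacement A B T x₀)) ∧
    -- at least one of the two conditions holds
    (ConditionD1 A B (Set.Ico 0 T) ∨ ConditionD2 A B (Set.Ico 0 T)) ∧
    -- the case of a combination of constant sign
    (ConditionD1 A B (Set.Ico 0 T) →
      (Abel.lyapunovConstant A B T 2 = 0 → Abel.lyapunovConstant A B T 3 = 0 →
        Abel.IsCenterAtZero A B T) ∧
      (Abel.lyapunovConstant A B T 2 = 0 → Abel.lyapunovConstant A B T 3 ≠ 0 →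
        Abel.IsLimitCycle A B T (fun _ => 0) ∧
        ∀ x, Abel.IsLimitCycle A B T x → ∀ t ∈ Set.Icc 0 T, x t = 0)) ∧
    -- the case of a nonvanishing Wronskian
    (ConditionD2 A B (Set.Ico 0 T) →
      (∃ m ≤ 4, Abel.IsLimitCycleOfMultiplicity A B T (fun _ => 0) m) ∧
      (Abel.lyapunovConstant A B T 2 = 0 → Abel.lyapunovConstant A B T 3 = 0 →
        ((∀ t ∈ Set.Ico 0 T, 0 < derivWithin A (Set.Ico 0 T) t * B t
            - A t * derivWithin B (Set.Ico 0 T) t) →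
          0 < Abel.lyapunovConstant A B T 4) ∧
        ((∀ t ∈ Set.Ico 0 T, derivWithin A (Set.Ico 0 T) t * B t
            - A t * derivWithin B (Set.Ico 0 T) t < 0) →
          Abel.lyapunovConstant A B T 4 < 0))) := by
  obtain ⟨a, b, k, ha, ha0, hb, hb0, hk, hk0⟩ := Abel.exists_primitives hT.le hA hB
  obtain ⟨v0, v1, v2, v3, v4⟩ := Abel.lyapunovConstant_eq hT.le hA hB ha ha0 hb hb0 hk hk0
  have haT : Abel.lyapunovConstant A B T 2 = 0 →
      a T = Abel.lyapunovConstant A B T 3 := fun h2 => by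
    rw [v2] at h2; rw [v3, h2]; ring
  have hsign := fun (h2 : Abel.lyapunovConstant A B T 2 = 0)
    (h3 : Abel.lyapunovConstant A B T 3 = 0) => Abel.primitive_sign_of_wronskian hT hA hB hET
      ha ha0 ((haT h2).trans h3) hb hb0 (v2 ▸ h2) hk hk0
  have hkT : Abel.lyapunovConstant A B T 2 = 0 →
      Abel.lyapunovConstant A B T 4 = k T := fun h2 => by
    rw [v2] at h2; rw [v4, h2]; ring
  refine ⟨Abel.hasSum_displacement hT.le hA hB, hET.conditionD1_or_conditionD2, fun hD => ?_,
    fun hD => ⟨?_, fun h2 h3 => ⟨fun hW => ?_, fun hW => ?_⟩⟩⟩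
  · obtain ⟨l, m, hlm, hf⟩ := hD.exists_nonneg
    refine ⟨fun h2 h3 => ?_, fun h2 h3 => ⟨Abel.isLimitCycle_zero hT.le hA hB h3, fun x hx => ?_⟩⟩
    · exact Abel.isCenterAtZero_of_conditionD1 hT ha ha0 ((haT h2).trans h3) hb hb0 (v2 ▸ h2) hlm hf
    · exact hx.1.eq_zero_of_conditionD1 hT hA hB ha ha0 (by rwa [haT h2]) hb hb0 (v2 ▸ h2) hlm hf
  -- Otherwise V₂ = V₃ = V₄ = 0, so the curve (a, b) is closed and k(T) = 0, against the sign of the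
  -- area. The multiplicity is the least such index.
  · have hex : ∃ m, Abel.lyapunovConstant A B T m ≠ 0 ∧ m ≤ 4 := by
      by_contra! hall
      have h0 : ∀ m ≤ 4, Abel.lyapunovConstant A B T m = 0 := fun m hm => by
        by_contra hne
        exact absurd (hall m hne) hm.not_gt
      have h2 := h0 2 (by norm_num)
      have h4 := hkT h2 ▸ h0 4 le_rfl
      obtain ⟨hpos, hneg⟩ := hsign h2 (h0 3 (by norm_num))
      exact hD.elim (fun hW => (hpos hW).ne h4) (fun hW => (hneg hW).ne' h4)
    classical
    obtain ⟨hm, hm4⟩ := Nat.find_spec hex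
    refine ⟨Nat.find hex, hm4, Abel.isLimitCycle_zero hT.le hA hB hm, fun j hj => ?_, ?_⟩
    · rw [Abel.iteratedDeriv_displacement]
      have := Nat.find_min hex hj
      push Not at this
      by_contra hne
      exact absurd (this (left_ne_zero_of_mul hne)) (by omega)
    · rw [Abel.iteratedDeriv_displacement]
      exact mul_ne_zero hm (by exact_mod_cast (Nat.factorial_ne_zero _))
  · rw [hkT h2]
    exact (hsign h2 h3).2 fun t ht => by linarith [hW t ht]
  · rw [hkT h2]
    exact (hsign h2 h3).1 fun t ht => by linarith [hW t ht]
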